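/- Let $K$ be a field of characteristic $0$, $\Gamma$ a finite abelian group, $H=K[\Gamma]$, and let $W=\bigoplus_{i=1}^{\theta}Kx_i$ be a quantum linear space with $x_i\in W_{g_i}^{\chi_i}$, $g_i\in\Gamma$, $\chi_i\in\widehat\Gamma$: that is, $\chi_i(g_j)\chi_j(g_i)=1$ for $i\neq j$, and $\chi_i(g_i)$ is a primitive $r_i$-th root of unity with $r_i\geq 2$. Let $A=\mathcal B(W)\#K[\Gamma]$ be the Radford biproduct of the Nichols algebra of $W$ with $H$; in it the elements of $\Gamma$ are group-like, $hx_i=\chi_i(h)x_ih$ for $h\in\Gamma$, and $\Delta(x_i)=x_i\otimes 1+g_i\otimes x_i$. Let $B=A(a_i,a_{ij}\mid 1\le i,j\le\theta)$ be an arbitrary lifting of $A$: the bialgebra generated by the group-likes $h\in\Gamma$ and by elements $x_1,\dots,x_\theta$ with $\Delta(x_i)=x_i\otimes 1+g_i\otimes x_i$, with the relations of $\Gamma$ and $$hx_i=\chi_i(h)x_ih,\qquad x_i^{r_i}=a_i(1-g_i^{r_i}),\qquad x_ix_j=\chi_j(g_i)x_jx_i+a_{ij}(1-g_ig_j)\quad(i\neq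 j),$$ where the scalars $a_i$, $a_{ij}$ ($i\ne j$) in $K$ satisfy $a_{ji}=-\chi_j(g_i)^{-1}a_{ij}$, and: if $a_i\neq0$ then $g_i^{r_i}\neq1$ and $\chi_i^{r_i}=\varepsilon$; if $a_{ij}\neq0$ then $g_ig_j\neq1$ and $\chi_i\chi_j=\varepsilon$. For $1\le s<\theta$ let $A_s$ be the subalgebra of $A$ generated by $x_1,\dots,x_s,g_1,\dots,g_s$. Then $A_s$ is spanned as a vector space by the elements $hx_1^{n_1}\cdots x_s^{n_s}$ with $h$ in the subgroup generated by $g_1,\dots,g_s$ and $0\le n_i\le r_i-1$. Let $\gamma\in Z^2_H(A,K)$, that is, $\gamma:A\otimes A\to K$ is a convolution invertible linear map such that for all $x,y,z\in A$ and $h,h'\in H$ $$\gamma(y_{(1)}\otimes z_{(1)})\,\gamma(x\otimes y_{(2)}z_{(2)})=\gamma(x_{(1)}\otimes y_{(1)})\,\gamma(x_{(2)}y_{(2)}\otimes z),$$ $$\gamma(x\otimes1)=\gamma(1\otimes x)=\varepsilon(x),\qquad \gamma(hx\otimes yh')=\varepsilon(h)\varepsilon(h')\gamma(x\otimes y).$$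 Suppose that 1. $\gamma(x_i^{n}\otimes x_i^{m})=\varepsilon(x_i^{n})\varepsilon(x_i^{m})$ for all $i$ and all $n,m\ge0$ with $n+m\le r_i-1$; 2. $\gamma(z\otimes x_s^{n})=\varepsilon(z)\varepsilon(x_s^{n})$ for all $1<s\le\theta$, all $z\in A_{s-1}$ and all $0\le n\le r_s-1$; 3. $\gamma(x_i^{r_i-1}\otimes x_i)=a_i$ for all $i$; 4. $\gamma(x_i\otimes x_j)=a_{ij}$ for all $1\le j<i\le\theta$. Let $A^\gamma$ be the bialgebra with the same coalgebra as $A$ and with multiplication the convolution product $\gamma*m_A*\gamma^{-1}$. Then $A^\gamma\cong B$ as bialgebras. -/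

import Mathlib

open scoped TensorProduct
open Coalgebra WithConv

noncomputable section

/-! ### Two-cocycles on a bialgebra and the twisted bialgebra -/

/-- Normalised two-cocycles `γ : A ⊗ A → K` on a bialgebra `A`: convolution invertible linear maps
with `γ(x ⊗ 1) = γ(1 ⊗ x) = ε(x)` and, in Sweedler notation,
`γ(y₁ ⊗ z₁) γ(x ⊗ y₂ z₂) = γ(x₁ ⊗ y₁) γ(x₂ y₂ ⊗ z)`. Here `ℛ K y` is a chosen way of writing
`Δ(y)` as a finite sum of pure tensors; the condition does not depend on the choice. -/
structure TwoCocycle (K A : Type*) [Field K] [Ring A] [Bialgebra K A] where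
  toLinearMap : A ⊗[K] A →ₗ[K] K
  isUnit : IsUnit (toConv toLinearMap)
  map_tmul_one : ∀ x : A, toLinearMap (x ⊗ₜ 1) = counit (R := K) x
  map_one_tmul : ∀ x : A, toLinearMap (1 ⊗ₜ x) = counit (R := K) x
  cocycle : ∀ x y z : A,
    (∑ j ∈ (ℛ K y).index, ∑ k ∈ (ℛ K z).index,
      toLinearMap ((ℛ K y).left j ⊗ₜ (ℛ K z).left k) *
        toLinearMap (x ⊗ₜ ((ℛ K y).right j * (ℛ K z).right k))) =
    ∑ i ∈ (ℛ K x).index, ∑ j ∈ (ℛ K y).index,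
      toLinearMap ((ℛ K x).left i ⊗ₜ (ℛ K y).left j) *
        toLinearMap (((ℛ K x).right i * (ℛ K y).right j) ⊗ₜ z)

namespace TwoCocycle

section Conv

variable {K C D E F : Type*} [Field K] [AddCommGroup C] [Module K C] [Coalgebra K C]
  [AddCommGroup D] [Module K D] [Coalgebra K D] [Ring E] [Algebra K E] [Ring F] [Algebra K F]

/-- Precomposition with a coalgebra map, as a homomorphism of convolution algebras. -/
def pull (E : Type*) [Ring E] [Algebra K E] (f : C →ₗc[K] D) :
    WithConv (D →ₗ[K] E) →* WithConv (C →ₗ[K] E) where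
  toFun u := toConv (u.ofConv ∘ₗ f.toLinearMap)
  map_one' := by ext c; simp
  map_mul' u v := by
    have := LinearMap.convMul_comp_coalgHom_distrib u v f
    exact congrArg toConv this

/-- A `K`-valued map regarded as an `E`-valued one, as a homomorphism of convolution algebras. -/
def scal (C E : Type*) [AddCommGroup C] [Module K C] [Coalgebra K C] [Ring E] [Algebra K E] :
    WithConv (C →ₗ[K] K) →* WithConv (C →ₗ[K] E) where
  toFun u := toConv (Algebra.linearMap K E ∘ₗ u.ofConv)
  map_one' := by ext c; simp
  map_mul' u v := by
    have := LinearMap.algHom_comp_convMul_distrib (Algebra.ofId K E) u v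
    exact congrArg toConv this

theorem push_scal_mul (f : E →ₗ[K] F) (u v : WithConv (C →ₗ[K] K)) (X : WithConv (C →ₗ[K] E)) :
    toConv (f ∘ₗ (scal C E u * X * scal C E v).ofConv) =
      scal C F u * toConv (f ∘ₗ X.ofConv) * scal C F v := by
  have h1 : ∀ Y : WithConv (C →ₗ[K] E), toConv (f ∘ₗ (Y * scal C E v).ofConv) =
      toConv (f ∘ₗ Y.ofConv) * scal C F v := by
    intro Y
    ext c
    change f ((Y * scal C E v) c) = (toConv (f ∘ₗ Y.ofConv) * scal C F v) c
    rw [(ℛ K c).convMul_apply, (ℛ K c).convMul_apply, map_sum]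
    refine Finset.sum_congr rfl fun i _ => ?_
    change f (_ * algebraMap K E (v _)) = f (Y _) * algebraMap K F (v _)
    rw [← Algebra.commutes, ← Algebra.smul_def, map_smul, ← Algebra.commutes, ← Algebra.smul_def]
  have h2 : toConv (f ∘ₗ (scal C E u * X).ofConv) = scal C F u * toConv (f ∘ₗ X.ofConv) := by
    ext c
    change f ((scal C E u * X) c) = (scal C F u * toConv (f ∘ₗ X.ofConv)) c
    rw [(ℛ K c).convMul_apply, (ℛ K c).convMul_apply, map_sum]
    refine Finset.sum_congr rfl fun i _ => ?_
    change f (algebraMap K E (u _) * _) = algebraMap K F (u _) * f (X _)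
    rw [← Algebra.smul_def, map_smul, ← Algebra.smul_def]
  rw [h1, h2]

end Conv

variable {K A : Type*} [Field K] [Ring A] [Bialgebra K A] (γ : TwoCocycle K A)

/-- `γ` as a unit of the convolution algebra; `γ.unit⁻¹` is the convolution inverse. -/
def unit : (WithConv (A ⊗[K] A →ₗ[K] K))ˣ := γ.isUnit.unit

theorem unit_val : (γ.unit : WithConv (A ⊗[K] A →ₗ[K] K)) = toConv γ.toLinearMap := rfl

/-- The convolution product `γ ∗ m_A ∗ γ⁻¹`. -/
def twistedMulConv : WithConv (A ⊗[K] A →ₗ[K] A) :=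
  scal _ A γ.unit.val * toConv (LinearMap.mul' K A) * scal _ A γ.unit⁻¹.val

/-- The twisted multiplication `γ ∗ m_A ∗ γ⁻¹ : A ⊗ A → A`. -/
def twistedMul : A ⊗[K] A →ₗ[K] A := γ.twistedMulConv.ofConv

theorem counit_comp_twistedMul :
    (counit (R := K) (A := A)) ∘ₗ γ.twistedMul = counit (R := K) (A := A ⊗[K] A) := by
  have h := push_scal_mul (counit (R := K) (A := A)) γ.unit.val γ.unit⁻¹.val
    (toConv (LinearMap.mul' K A))
  have h1 : (toConv (counit (R := K) (A := A) ∘ₗ LinearMap.mul' K A) :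
      WithConv (A ⊗[K] A →ₗ[K] K)) = 1 := by
    ext a b
    simp [mul_comm]
  have h2 : ∀ u : WithConv (A ⊗[K] A →ₗ[K] K), scal (A ⊗[K] A) K u = u := fun u => by
    ext a b; simp [scal]
  rw [show (toConv (LinearMap.mul' K A)).ofConv = LinearMap.mul' K A from rfl, h1, mul_one,
    h2, h2, Units.mul_inv] at h
  have := congrArg ofConv h
  refine this.trans ?_
  ext a b
  simp

theorem comul_comp_twistedMul :
    TensorProduct.map γ.twistedMul γ.twistedMul ∘ₗ comul (R := K) (A := A ⊗[K] A) =
      comul (R := K) (A := A) ∘ₗ γ.twistedMul := by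
  set u := γ.unit
  have hl := LinearMap.algHom_comp_convMul_distrib (R := K) (C := A ⊗[K] A)
    (Algebra.TensorProduct.includeLeft : A →ₐ[K] A ⊗[K] A)
  let L : A →ₗ[K] A ⊗[K] A :=
    (Algebra.TensorProduct.includeLeft : A →ₐ[K] A ⊗[K] A).toLinearMap
  let R : A →ₗ[K] A ⊗[K] A :=
    (Algebra.TensorProduct.includeRight : A →ₐ[K] A ⊗[K] A).toLinearMap
  have key : ∀ f g : A ⊗[K] A →ₗ[K] A,
      toConv (TensorProduct.map f g ∘ₗ comul (R := K) (A := A ⊗[K] A)) =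
        toConv (L ∘ₗ f) * toConv (R ∘ₗ g) := by
    intro f g
    refine WithConv.ext (LinearMap.ext fun c => ?_)
    refine Eq.trans ?_ ((ℛ K c).convMul_apply (toConv (L ∘ₗ f)) (toConv (R ∘ₗ g))).symm
    change TensorProduct.map f g (comul c) = _
    conv_lhs => rw [← (ℛ K c).eq]
    rw [map_sum]
    refine Finset.sum_congr rfl fun i _ => ?_
    change _ = (f _ ⊗ₜ[K] (1 : A)) * ((1 : A) ⊗ₜ[K] g _)
    simp
  apply toConv_injective
  rw [key]
  have e1 := push_scal_mul L u.val u⁻¹.val (toConv (LinearMap.mul' K A))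
  have e2 := push_scal_mul R u.val u⁻¹.val (toConv (LinearMap.mul' K A))
  have e3 := push_scal_mul (comul (R := K) (A := A)) u.val u⁻¹.val (toConv (LinearMap.mul' K A))
  change toConv (L ∘ₗ γ.twistedMul) = _ at e1
  change toConv (R ∘ₗ γ.twistedMul) = _ at e2
  change toConv (comul ∘ₗ γ.twistedMul) = _ at e3
  rw [e1, e2, e3]
  have hc : scal (A ⊗[K] A) (A ⊗[K] A) u⁻¹.val * scal (A ⊗[K] A) (A ⊗[K] A) u.val = 1 := by
    rw [← map_mul, Units.inv_mul, map_one]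
  have hm := key (LinearMap.mul' K A) (LinearMap.mul' K A)
  rw [show TensorProduct.map (LinearMap.mul' K A) (LinearMap.mul' K A) ∘ₗ
    comul (R := K) (A := A ⊗[K] A) = comul ∘ₗ LinearMap.mul' K A from
      (Bialgebra.mulCoalgHom K A).map_comp_comul] at hm
  change _ = scal _ _ u.val * toConv (comul ∘ₗ LinearMap.mul' K A) * _
  rw [hm]
  simp only [mul_assoc]
  rw [← mul_assoc (scal (A ⊗[K] A) (A ⊗[K] A) u⁻¹.val), hc, one_mul]

/-- The twisted multiplication is a map of coalgebras. -/
def twistedMulCoalgHom : A ⊗[K] A →ₗc[K] A where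
  toLinearMap := γ.twistedMul
  counit_comp := γ.counit_comp_twistedMul
  map_comp_comul := γ.comul_comp_twistedMul

/-- `x ↦ x ⊗ 1` as a map of coalgebras. -/
def inlCoalgHom (K A : Type*) [Field K] [Ring A] [Bialgebra K A] : A →ₗc[K] A ⊗[K] A where
  toLinearMap := (TensorProduct.mk K A A).flip 1
  counit_comp := by ext x; simp
  map_comp_comul := by
    ext x
    simp [← (ℛ K x).eq, TensorProduct.sum_tmul, Algebra.TensorProduct.one_def]

/-- `x ↦ 1 ⊗ x` as a map of coalgebras. -/
def inrCoalgHom (K A : Type*) [Field K] [Ring A] [Bialgebra K A] : A →ₗc[K] A ⊗[K] A where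
  toLinearMap := TensorProduct.mk K A A 1
  counit_comp := by ext x; simp
  map_comp_comul := by
    ext x
    simp [← (ℛ K x).eq, TensorProduct.tmul_sum, Algebra.TensorProduct.one_def]

theorem pull_twistedMulConv {C : Type*} [AddCommGroup C] [Module K C] [Coalgebra K C]
    (f : C →ₗc[K] A ⊗[K] A) :
    pull A f γ.twistedMulConv = scal _ A (pull K f γ.unit.val) *
      toConv (LinearMap.mul' K A ∘ₗ f.toLinearMap) * scal _ A (pull K f γ.unit⁻¹.val) := by
  rw [twistedMulConv, map_mul, map_mul]
  rfl

theorem twistedMul_comp_of_pull_eq_one (f : A →ₗc[K] A ⊗[K] A)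
    (hu : pull K f γ.unit.val = 1) (hm : LinearMap.mul' K A ∘ₗ f.toLinearMap = .id) (x : A) :
    γ.twistedMul (f x) = x := by
  have h := γ.pull_twistedMulConv f
  have hv : pull K f γ.unit⁻¹.val = 1 := by
    have : pull K f γ.unit.val * pull K f γ.unit⁻¹.val = 1 := by
      rw [← map_mul, Units.mul_inv, map_one]
    rwa [hu, one_mul] at this
  rw [hu, hv, hm, map_one, one_mul, mul_one] at h
  exact congrArg (fun g : WithConv (A →ₗ[K] A) => g x) h

theorem twistedMul_tmul_one (x : A) : γ.twistedMul (x ⊗ₜ 1) = x := by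
  refine γ.twistedMul_comp_of_pull_eq_one (inlCoalgHom K A) ?_ ?_ x
  · ext y
    exact γ.map_tmul_one y
  · ext y
    exact mul_one y

theorem twistedMul_one_tmul (x : A) : γ.twistedMul (1 ⊗ₜ x) = x := by
  refine γ.twistedMul_comp_of_pull_eq_one (inrCoalgHom K A) ?_ ?_ x
  · ext y
    exact γ.map_one_tmul y
  · ext y
    exact one_mul y

/-- `(x ⊗ y) ⊗ z ↦ ε(z) x ⊗ y`. -/
def dropRight (K A : Type*) [Field K] [Ring A] [Bialgebra K A] :
    (A ⊗[K] A) ⊗[K] A →ₗc[K] A ⊗[K] A :=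
  (Coalgebra.TensorProduct.rid K K (A ⊗[K] A)).toCoalgHom.comp
    (Coalgebra.TensorProduct.map (CoalgHom.id K (A ⊗[K] A)) (counitCoalgHom K A))

/-- `x ⊗ (y ⊗ z) ↦ ε(x) y ⊗ z`. -/
def dropLeft (K A : Type*) [Field K] [Ring A] [Bialgebra K A] :
    A ⊗[K] (A ⊗[K] A) →ₗc[K] A ⊗[K] A :=
  (Coalgebra.TensorProduct.lid K (A ⊗[K] A)).toCoalgHom.comp
    (Coalgebra.TensorProduct.map (counitCoalgHom K A) (CoalgHom.id K (A ⊗[K] A)))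

theorem pull_mul_right {E : Type*} [Ring E] [Algebra K E] (X : WithConv (A ⊗[K] A →ₗ[K] E)) :
    pull E (Coalgebra.TensorProduct.map γ.twistedMulCoalgHom (CoalgHom.id K A)) X =
      scal _ E (pull K (dropRight K A) γ.unit.val) *
        pull E (Coalgebra.TensorProduct.map (Bialgebra.mulCoalgHom K A) (CoalgHom.id K A)) X *
        scal _ E (pull K (dropRight K A) γ.unit⁻¹.val) := by
  have hs : ∀ w : WithConv (A ⊗[K] A →ₗ[K] K),
      scal ((A ⊗[K] A) ⊗[K] A) (A ⊗[K] A) (pull K (dropRight K A) w) =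
        toConv (TensorProduct.map (scal (A ⊗[K] A) A w).ofConv
          (1 : WithConv (A →ₗ[K] A)).ofConv) := by
    intro w
    ext x y z
    change algebraMap K (A ⊗[K] A) (w.ofConv (counit (R := K) z • (x ⊗ₜ[K] y))) =
      algebraMap K A (w.ofConv (x ⊗ₜ[K] y)) ⊗ₜ[K] algebraMap K A (counit z)
    rw [map_smul, smul_eq_mul]
    simp only [Algebra.algebraMap_eq_smul_one, Algebra.TensorProduct.one_def,
      TensorProduct.tmul_smul, ← TensorProduct.smul_tmul', smul_smul]
  have h := push_scal_mul X.ofConv (pull K (dropRight K A) γ.unit.val)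
    (pull K (dropRight K A) γ.unit⁻¹.val)
    (toConv (TensorProduct.map (LinearMap.mul' K A) (.id : A →ₗ[K] A)))
  refine Eq.trans ?_ h
  rw [hs, hs, show (toConv (TensorProduct.map (LinearMap.mul' K A) (.id : A →ₗ[K] A))) =
    toConv (TensorProduct.map (toConv (LinearMap.mul' K A)).ofConv
      (toConv (.id : A →ₗ[K] A)).ofConv) from rfl,
    TensorProduct.map_convMul_map, TensorProduct.map_convMul_map, one_mul, mul_one]
  rfl

theorem pull_mul_left {E : Type*} [Ring E] [Algebra K E] (X : WithConv (A ⊗[K] A →ₗ[K] E)) :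
    pull E (Coalgebra.TensorProduct.map (CoalgHom.id K A) γ.twistedMulCoalgHom) X =
      scal _ E (pull K (dropLeft K A) γ.unit.val) *
        pull E (Coalgebra.TensorProduct.map (CoalgHom.id K A) (Bialgebra.mulCoalgHom K A)) X *
        scal _ E (pull K (dropLeft K A) γ.unit⁻¹.val) := by
  have hs : ∀ w : WithConv (A ⊗[K] A →ₗ[K] K),
      scal (A ⊗[K] (A ⊗[K] A)) (A ⊗[K] A) (pull K (dropLeft K A) w) =
        toConv (TensorProduct.map (1 : WithConv (A →ₗ[K] A)).ofConv
          (scal (A ⊗[K] A) A w).ofConv) := by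
    intro w
    ext x y z
    change algebraMap K (A ⊗[K] A) (w.ofConv (counit (R := K) x • (y ⊗ₜ[K] z))) =
      algebraMap K A (counit x) ⊗ₜ[K] algebraMap K A (w.ofConv (y ⊗ₜ[K] z))
    rw [map_smul, smul_eq_mul, mul_comm]
    simp only [Algebra.algebraMap_eq_smul_one, Algebra.TensorProduct.one_def,
      TensorProduct.tmul_smul, ← TensorProduct.smul_tmul', smul_smul]
  have h := push_scal_mul X.ofConv (pull K (dropLeft K A) γ.unit.val)
    (pull K (dropLeft K A) γ.unit⁻¹.val)
    (toConv (TensorProduct.map (.id : A →ₗ[K] A) (LinearMap.mul' K A)))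
  refine Eq.trans ?_ h
  rw [hs, hs, show (toConv (TensorProduct.map (.id : A →ₗ[K] A) (LinearMap.mul' K A))) =
    toConv (TensorProduct.map (toConv (.id : A →ₗ[K] A)).ofConv
      (toConv (LinearMap.mul' K A)).ofConv) from rfl,
    TensorProduct.map_convMul_map, TensorProduct.map_convMul_map, one_mul, mul_one]
  rfl

theorem pull_scal {C D : Type*} [AddCommGroup C] [Module K C] [Coalgebra K C] [AddCommGroup D]
    [Module K D] [Coalgebra K D] (E : Type*) [Ring E] [Algebra K E] (f : C →ₗc[K] D)
    (w : WithConv (D →ₗ[K] K)) : pull E f (scal D E w) = scal C E (pull K f w) := rfl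

/-- The cocycle identity in the convolution algebra of `A ⊗ A ⊗ A`. -/
theorem cocycle_conv :
    pull K (Coalgebra.TensorProduct.assoc K K A A A).toCoalgHom
      (pull K (dropLeft K A) γ.unit.val *
        pull K (Coalgebra.TensorProduct.map (CoalgHom.id K A) (Bialgebra.mulCoalgHom K A))
          γ.unit.val) =
    pull K (dropRight K A) γ.unit.val *
      pull K (Coalgebra.TensorProduct.map (Bialgebra.mulCoalgHom K A) (CoalgHom.id K A))
        γ.unit.val := by
  apply WithConv.ext
  apply TensorProduct.ext_threefold
  intro x y z
  have hx : ∑ i ∈ (ℛ K x).index, counit (R := K) ((ℛ K x).left i) • (ℛ K x).right i = x :=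
    sum_counit_smul (ℛ K x)
  have hz : ∑ i ∈ (ℛ K z).index, counit (R := K) ((ℛ K z).left i) • (ℛ K z).right i = z :=
    sum_counit_smul (ℛ K z)
  refine Eq.trans (((ℛ K x).tmul ((ℛ K y).tmul (ℛ K z))).convMul_apply _ _) (Eq.trans ?_
    (((((ℛ K x).tmul (ℛ K y)).tmul (ℛ K z)).convMul_apply _ _).symm))
  have hc := γ.cocycle x y z
  refine Eq.trans ?_ (hc.trans ?_)
  · simp only [Coalgebra.Repr.tmul, Finset.sum_product, pull, dropLeft, unit_val]
    conv_rhs => rw [← hx]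
    simp only [MonoidHom.coe_mk, OneHom.coe_mk, LinearMap.comp_apply]
    simp [TensorProduct.sum_tmul, ← TensorProduct.smul_tmul', Finset.mul_sum]
    rw [Finset.sum_comm]
    refine Finset.sum_congr rfl fun j _ => ?_
    rw [Finset.sum_comm]
    refine Finset.sum_congr rfl fun k _ => Finset.sum_congr rfl fun i _ => ?_
    ring
  · simp only [Coalgebra.Repr.tmul, Finset.sum_product, pull, dropRight, unit_val]
    conv_lhs => rw [← hz]
    simp [TensorProduct.tmul_sum, TensorProduct.tmul_smul, Finset.mul_sum]
    refine Finset.sum_congr rfl fun j _ => Finset.sum_congr rfl fun k _ =>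
      Finset.sum_congr rfl fun i _ => ?_
    ring

theorem twistedMul_assoc_aux :
    pull A (Coalgebra.TensorProduct.assoc K K A A A).toCoalgHom
      (pull A (Coalgebra.TensorProduct.map (CoalgHom.id K A) γ.twistedMulCoalgHom)
          γ.twistedMulConv) =
      pull A (Coalgebra.TensorProduct.map γ.twistedMulCoalgHom (CoalgHom.id K A))
          γ.twistedMulConv := by
  set as := (Coalgebra.TensorProduct.assoc K K A A A).toCoalgHom with has
  set mr := Coalgebra.TensorProduct.map (Bialgebra.mulCoalgHom K A) (CoalgHom.id K A) with hmr
  set ml := Coalgebra.TensorProduct.map (CoalgHom.id K A) (Bialgebra.mulCoalgHom K A) with hml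
  have h1 := γ.cocycle_conv
  let P : (WithConv ((A ⊗[K] A) ⊗[K] A →ₗ[K] K))ˣ :=
    Units.map (pull K as) (Units.map (pull K (dropLeft K A)) γ.unit * Units.map (pull K ml) γ.unit)
  let Q : (WithConv ((A ⊗[K] A) ⊗[K] A →ₗ[K] K))ˣ :=
    Units.map (pull K (dropRight K A)) γ.unit * Units.map (pull K mr) γ.unit
  have hPQ : P = Q := Units.ext h1
  have hm : pull A as (pull A ml (toConv (LinearMap.mul' K A))) =
      pull A mr (toConv (LinearMap.mul' K A)) := by
    apply WithConv.ext
    apply TensorProduct.ext_threefold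
    intro x y z
    exact (mul_assoc x y z).symm
  have hl : pull A as (pull A (Coalgebra.TensorProduct.map (CoalgHom.id K A)
      γ.twistedMulCoalgHom) γ.twistedMulConv) =
      scal _ A P.val * pull A mr (toConv (LinearMap.mul' K A)) * scal _ A P⁻¹.val := by
    rw [pull_mul_left, twistedMulConv, ← hml, ← hm]
    simp only [P, map_mul, mul_inv_rev, Units.val_mul, Units.coe_map, Units.coe_map_inv,
      pull_scal, mul_assoc]
  have hr : pull A (Coalgebra.TensorProduct.map γ.twistedMulCoalgHom (CoalgHom.id K A))
          γ.twistedMulConv =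
      scal _ A Q.val * pull A mr (toConv (LinearMap.mul' K A)) * scal _ A Q⁻¹.val := by
    rw [pull_mul_right, twistedMulConv, ← hmr]
    simp only [Q, map_mul, mul_inv_rev, Units.val_mul, Units.coe_map, Units.coe_map_inv,
      pull_scal, mul_assoc]
  rw [hl, hr, hPQ]

theorem twistedMul_assoc (x y z : A) :
    γ.twistedMul (γ.twistedMul (x ⊗ₜ y) ⊗ₜ z) = γ.twistedMul (x ⊗ₜ γ.twistedMul (y ⊗ₜ z)) :=
  (congrArg (fun g : WithConv ((A ⊗[K] A) ⊗[K] A →ₗ[K] A) => g ((x ⊗ₜ y) ⊗ₜ z))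
    γ.twistedMul_assoc_aux).symm

/-- The underlying space of the twisted bialgebra `A^γ`: the coalgebra `A`, with multiplication
`γ ∗ m_A ∗ γ⁻¹`. -/
def Twist (_γ : TwoCocycle K A) : Type _ := A

instance : AddCommGroup γ.Twist := inferInstanceAs (AddCommGroup A)

instance : Module K γ.Twist := inferInstanceAs (Module K A)

instance : Coalgebra K γ.Twist := inferInstanceAs (Coalgebra K A)

/-- The identity map `A → A^γ`, an isomorphism of coalgebras. -/
def toTwist : A ≃ₗc[K] γ.Twist := CoalgEquiv.refl K A

instance : Ring γ.Twist where
  __ := (inferInstance : AddCommGroup γ.Twist)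
  mul x y := γ.toTwist (γ.twistedMul (γ.toTwist.symm x ⊗ₜ γ.toTwist.symm y))
  one := γ.toTwist 1
  zero_mul x := LinearMap.map_zero₂ (TensorProduct.curry γ.twistedMul) x
  mul_zero x := LinearMap.map_zero (TensorProduct.curry γ.twistedMul x)
  left_distrib x y z := LinearMap.map_add (TensorProduct.curry γ.twistedMul x) y z
  right_distrib x y z := LinearMap.map_add₂ (TensorProduct.curry γ.twistedMul) x y z
  mul_assoc := γ.twistedMul_assoc
  one_mul := γ.twistedMul_one_tmul
  mul_one := γ.twistedMul_tmul_one

theorem toTwist_mul_toTwist (x y : A) :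
    γ.toTwist x * γ.toTwist y = γ.toTwist (γ.twistedMul (x ⊗ₜ y)) := rfl

theorem toTwist_one : γ.toTwist 1 = 1 := rfl

instance : Algebra K γ.Twist :=
  Algebra.ofModule
    (fun c x y => LinearMap.map_smul₂ (TensorProduct.curry γ.twistedMul) c x y)
    (fun c x y => LinearMap.map_smul (TensorProduct.curry γ.twistedMul x) c y)

theorem mul'_twist : (LinearMap.mul' K γ.Twist : γ.Twist ⊗[K] γ.Twist →ₗ[K] γ.Twist) =
    (show A ⊗[K] A →ₗ[K] A from γ.twistedMul) := by
  apply TensorProduct.ext'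
  intro x y
  rfl

theorem twist_comul_mul (x y : γ.Twist) :
    comul (R := K) (x * y) = comul (R := K) x * comul (R := K) y := by
  have h : ∀ a b : γ.Twist ⊗[K] γ.Twist, a * b =
      TensorProduct.map (LinearMap.mul' K γ.Twist) (LinearMap.mul' K γ.Twist)
        (TensorProduct.tensorTensorTensorComm K _ _ _ _ (a ⊗ₜ b)) := fun a b =>
    LinearMap.congr_fun (LinearMap.mul'_tensor (R := K) (A := γ.Twist) (B := γ.Twist)) (a ⊗ₜ[K] b)
  rw [h, mul'_twist]
  exact (congrArg (fun f => f (x ⊗ₜ[K] y)) γ.comul_comp_twistedMul).symm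

instance : Bialgebra K γ.Twist :=
  Bialgebra.mk' K γ.Twist (Bialgebra.counit_one (R := K) (A := A))
    (fun {x y} =>
      congrArg (fun f => f (x ⊗ₜ[K] y)) γ.counit_comp_twistedMul |>.trans (mul_comm _ _))
    (Bialgebra.comul_one (R := K) (A := A))
    (fun {x y} => γ.twist_comul_mul x y)

/-- `γ` is bilinear over the subalgebra `H`: `γ(h a ⊗ b h') = ε(h) ε(h') γ(a ⊗ b)`. -/
def IsBilinearOver (H : Subalgebra K A) : Prop :=
  ∀ h ∈ H, ∀ h' ∈ H, ∀ a b : A,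
    γ.toLinearMap ((h * a) ⊗ₜ (b * h')) =
      counit (R := K) h * counit (R := K) h' * γ.toLinearMap (a ⊗ₜ b)

end TwoCocycle

/-! ### The quantum binomial formula -/

/-- Gaussian binomial coefficients. -/
def qBinom {K : Type*} [Field K] (q : K) : ℕ → ℕ → K
  | _, 0 => 1
  | 0, _ + 1 => 0
  | n + 1, k + 1 => qBinom q n k + q ^ (k + 1) * qBinom q n (k + 1)

theorem qBinom_zero {K : Type*} [Field K] (q : K) (n : ℕ) : qBinom q n 0 = 1 := by
  cases n <;> rfl

theorem qBinom_eq_zero {K : Type*} [Field K] (q : K) (n k : ℕ) (h : n < k) : qBinom q n k = 0 := by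
  induction n generalizing k with
  | zero =>
    cases k with
    | zero => omega
    | succ k => rfl
  | succ n ih =>
    cases k with
    | zero => omega
    | succ k => rw [qBinom, ih k (by omega), ih (k + 1) (by omega)]; ring

theorem qBinom_self {K : Type*} [Field K] (q : K) (n : ℕ) : qBinom q n n = 1 := by
  induction n with
  | zero => rfl
  | succ n ih => rw [qBinom, ih, qBinom_eq_zero q n (n + 1) (by omega)]; ring

theorem qBinom_mul {K : Type*} [Field K] (q : K) (n k : ℕ) :
    qBinom q n (k + 1) * (q ^ (k + 1) - 1) * q ^ k = qBinom q n k * (q ^ n - q ^ k) := by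
  induction n generalizing k with
  | zero =>
    cases k with
    | zero => simp [qBinom]
    | succ k => simp [qBinom]
  | succ n ih =>
    cases k with
    | zero =>
      have := ih 0
      simp only [qBinom, qBinom_zero] at this ⊢
      linear_combination q * this
    | succ k =>
      have h1 := ih (k + 1)
      have h2 := ih k
      simp only [qBinom] at h1 h2 ⊢
      linear_combination q ^ (k + 2) * h1 + q * h2

theorem qBinom_eq_zero_of_isPrimitiveRoot {K : Type*} [Field K] {q : K} {r : ℕ}
    (hq : IsPrimitiveRoot q r) (k : ℕ) (hk : k + 1 < r) : qBinom q r (k + 1) = 0 := by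
  have hq0 : q ≠ 0 := hq.ne_zero (by omega)
  have h1 : q ^ (k + 1) - 1 ≠ 0 :=
    sub_ne_zero.mpr (hq.pow_ne_one_of_pos_of_lt (by omega) hk)
  have h := qBinom_mul q r k
  have h2 : qBinom q r k * (q ^ r - q ^ k) = 0 := by
    cases k with
    | zero => simp [hq.pow_eq_one]
    | succ j => rw [qBinom_eq_zero_of_isPrimitiveRoot hq j (by omega), zero_mul]
  rw [h2] at h
  simpa [h1, hq0] using h

theorem add_pow_eq_sum_qBinom {K T : Type*} [Field K] [Ring T] [Algebra K T] (q : K) (X Y : T)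
    (h : Y * X = q • (X * Y)) (n : ℕ) :
    (X + Y) ^ n = ∑ k ∈ Finset.range (n + 1), qBinom q n k • (X ^ k * Y ^ (n - k)) := by
  have hc : ∀ k, Y * X ^ k = q ^ k • (X ^ k * Y) := by
    intro k
    induction k with
    | zero => simp
    | succ k ih =>
      rw [pow_succ X, ← mul_assoc, ih, smul_mul_assoc, mul_assoc, h, mul_smul_comm, smul_smul,
        ← mul_assoc, pow_succ]
  induction n with
  | zero => simp [qBinom]
  | succ n ih =>
    have e1 : Y * ∑ k ∈ Finset.range (n + 1), qBinom q n k • (X ^ k * Y ^ (n - k)) =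
        ∑ k ∈ Finset.range (n + 2), (q ^ k * qBinom q n k) • (X ^ k * Y ^ (n + 1 - k)) := by
      rw [Finset.sum_range_succ _ (n + 1), qBinom_eq_zero q n (n + 1) (by omega), mul_zero,
        zero_smul, add_zero, Finset.mul_sum]
      refine Finset.sum_congr rfl fun k hk => ?_
      have hk' : k ≤ n := by simpa [Nat.lt_succ_iff] using hk
      rw [mul_smul_comm, ← mul_assoc, hc, smul_mul_assoc, smul_smul, mul_assoc, ← pow_succ',
        mul_comm, Nat.sub_add_comm hk']
    have e2 : X * ∑ k ∈ Finset.range (n + 1), qBinom q n k • (X ^ k * Y ^ (n - k)) =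
        ∑ k ∈ Finset.range (n + 1), qBinom q n k • (X ^ (k + 1) * Y ^ (n + 1 - (k + 1))) := by
      rw [Finset.mul_sum]
      refine Finset.sum_congr rfl fun k _ => ?_
      rw [mul_smul_comm, ← mul_assoc, ← pow_succ', Nat.add_sub_add_right]
    rw [pow_succ', ih, add_mul, e1, e2, Finset.sum_range_succ' _ (n + 1),
      Finset.sum_range_succ' _ (n + 1), ← add_assoc, ← Finset.sum_add_distrib]
    congr 1
    · refine Finset.sum_congr rfl fun k _ => ?_
      rw [← add_smul, qBinom]
    · simp [qBinom_zero]

theorem add_pow_eq_of_isPrimitiveRoot {K T : Type*} [Field K] [Ring T] [Algebra K T] {q : K}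
    {r : ℕ} (hq : IsPrimitiveRoot q r) (hr : 2 ≤ r) (X Y : T) (h : Y * X = q • (X * Y)) :
    (X + Y) ^ r = X ^ r + Y ^ r := by
  obtain ⟨s, rfl⟩ : ∃ s, r = s + 1 := ⟨r - 1, by omega⟩
  rw [add_pow_eq_sum_qBinom q X Y h, Finset.sum_range_succ, Finset.sum_range_succ',
    Finset.sum_eq_zero, qBinom_self, qBinom_zero]
  · simp [add_comm]
  · intro k hk
    rw [qBinom_eq_zero_of_isPrimitiveRoot hq k (by simpa using hk), zero_smul]

/-! ### Quantum linear spaces and the associated Hopf algebras -/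

/-- The data of a quantum linear space `W = ⊕ K xᵢ` of rank `θ` over a group `Γ`: group elements
`gᵢ` and characters `χᵢ` such that `xᵢ ∈ W_{gᵢ}^{χᵢ}`, subject to the two conditions
`χᵢ(gⱼ) χⱼ(gᵢ) = 1` for `i ≠ j` and `χᵢ(gᵢ)` a primitive `rᵢ`-th root of unity, `rᵢ ≥ 2`. -/
structure QuantumLinearSpace (K Γ : Type*) [Field K] [CommGroup Γ] (θ : ℕ) where
  g : Fin θ → Γ
  χ : Fin θ → Γ →* Kˣ
  r : Fin θ → ℕ
  two_le_r : ∀ i, 2 ≤ r i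
  χ_mul_χ : ∀ i j, i ≠ j → χ i (g j) * χ j (g i) = 1
  isPrimitiveRoot : ∀ i, IsPrimitiveRoot (χ i (g i) : K) (r i)

namespace QuantumLinearSpace

variable {K Γ : Type*} [Field K] [CommGroup Γ] {θ : ℕ} (D : QuantumLinearSpace K Γ θ)

/-- The defining relations of `T(W) # K[Γ]` on generators `h ∈ Γ` and `x₁, …, x_θ`: the
multiplication table of `Γ`, and `h xᵢ = χᵢ(h) xᵢ h`. -/
inductive TensorRel : FreeAlgebra K (Γ ⊕ Fin θ) → FreeAlgebra K (Γ ⊕ Fin θ) → Prop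
  | one : TensorRel (FreeAlgebra.ι K (Sum.inl 1)) 1
  | mul (h k : Γ) : TensorRel (FreeAlgebra.ι K (Sum.inl (h * k)))
      (FreeAlgebra.ι K (Sum.inl h) * FreeAlgebra.ι K (Sum.inl k))
  | comm (h : Γ) (i : Fin θ) :
      TensorRel (FreeAlgebra.ι K (Sum.inl h) * FreeAlgebra.ι K (Sum.inr i))
        ((D.χ i h : K) • (FreeAlgebra.ι K (Sum.inr i) * FreeAlgebra.ι K (Sum.inl h)))

/-- The biproduct `T(W) # K[Γ]` of the tensor algebra of `W` with the group algebra of `Γ`. -/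
def TensorBiproduct : Type _ := RingQuot D.TensorRel

instance : Ring D.TensorBiproduct := inferInstanceAs (Ring (RingQuot D.TensorRel))

instance : Algebra K D.TensorBiproduct := inferInstanceAs (Algebra K (RingQuot D.TensorRel))

namespace TensorBiproduct

/-- The quotient map from the free algebra. -/
def mk : FreeAlgebra K (Γ ⊕ Fin θ) →ₐ[K] D.TensorBiproduct := RingQuot.mkAlgHom K D.TensorRel

/-- The group element `h ∈ Γ` in `T(W) # K[Γ]`. -/
def grp (h : Γ) : D.TensorBiproduct := mk D (FreeAlgebra.ι K (Sum.inl h))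

/-- The generator `xᵢ` in `T(W) # K[Γ]`. -/
def x (i : Fin θ) : D.TensorBiproduct := mk D (FreeAlgebra.ι K (Sum.inr i))

theorem grp_one : grp D 1 = 1 :=
  (RingQuot.mkAlgHom_rel K (TensorRel.one (D := D))).trans (map_one _)

theorem grp_mul (h k : Γ) : grp D (h * k) = grp D h * grp D k :=
  (RingQuot.mkAlgHom_rel K (TensorRel.mul (D := D) h k)).trans (map_mul _ _ _)

theorem grp_mul_x (h : Γ) (i : Fin θ) : grp D h * x D i = (D.χ i h : K) • (x D i * grp D h) := by
  have := RingQuot.mkAlgHom_rel K (TensorRel.comm (D := D) h i)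
  rw [map_mul, map_smul, map_mul] at this
  exact this

variable {D}

theorem algHom_ext {B : Type*} [Semiring B] [Algebra K B] {f f' : D.TensorBiproduct →ₐ[K] B}
    (hg : ∀ h, f (grp D h) = f' (grp D h)) (hx : ∀ i, f (x D i) = f' (x D i)) : f = f' := by
  apply RingQuot.ringQuot_ext'
  apply FreeAlgebra.hom_ext
  funext s
  cases s with
  | inl h => exact hg h
  | inr i => exact hx i

/-- The universal property of the presentation. -/
def lift {B : Type*} [Semiring B] [Algebra K B] (G : Γ → B) (X : Fin θ → B) (h1 : G 1 = 1)
    (hm : ∀ h k, G (h * k) = G h * G k)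
    (hc : ∀ h i, G h * X i = (D.χ i h : K) • (X i * G h)) : D.TensorBiproduct →ₐ[K] B :=
  RingQuot.liftAlgHom K ⟨FreeAlgebra.lift K (Sum.elim G X), by
    intro a b hab
    cases hab with
    | one => simpa using h1
    | mul h k => simpa using hm h k
    | comm h i => simpa using hc h i⟩

theorem lift_grp {B : Type*} [Semiring B] [Algebra K B] (G : Γ → B) (X : Fin θ → B) (h1 hm hc)
    (h : Γ) : lift (D := D) G X h1 hm hc (grp D h) = G h :=
  (RingQuot.liftAlgHom_mkAlgHom_apply K _ _ _).trans (by simp)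

theorem lift_x {B : Type*} [Semiring B] [Algebra K B] (G : Γ → B) (X : Fin θ → B) (h1 hm hc)
    (i : Fin θ) : lift (D := D) G X h1 hm hc (x D i) = X i :=
  (RingQuot.liftAlgHom_mkAlgHom_apply K _ _ _).trans (by simp)

variable (D)

theorem comul_aux_one : grp D 1 ⊗ₜ[K] grp D 1 = 1 := by
  rw [grp_one]; rfl

theorem comul_aux_mul (h k : Γ) :
    grp D (h * k) ⊗ₜ[K] grp D (h * k) = grp D h ⊗ₜ[K] grp D h * grp D k ⊗ₜ[K] grp D k := by
  rw [Algebra.TensorProduct.tmul_mul_tmul, grp_mul]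

theorem comul_aux_comm (h : Γ) (i : Fin θ) :
    grp D h ⊗ₜ[K] grp D h * (x D i ⊗ₜ[K] 1 + grp D (D.g i) ⊗ₜ[K] x D i) =
      (D.χ i h : K) •
        ((x D i ⊗ₜ[K] 1 + grp D (D.g i) ⊗ₜ[K] x D i) * grp D h ⊗ₜ[K] grp D h) := by
  simp only [mul_add, add_mul, Algebra.TensorProduct.tmul_mul_tmul, grp_mul_x, mul_one, one_mul,
    ← grp_mul, mul_comm h, smul_add, TensorProduct.smul_tmul', TensorProduct.tmul_smul]

/-- The comultiplication: `Δ(h) = h ⊗ h` and `Δ(xᵢ) = xᵢ ⊗ 1 + gᵢ ⊗ xᵢ`. -/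
def comulHom : D.TensorBiproduct →ₐ[K] D.TensorBiproduct ⊗[K] D.TensorBiproduct :=
  lift (fun h => grp D h ⊗ₜ grp D h) (fun i => x D i ⊗ₜ 1 + grp D (D.g i) ⊗ₜ x D i)
    (comul_aux_one D) (comul_aux_mul D) (comul_aux_comm D)

/-- The counit: `ε(h) = 1` and `ε(xᵢ) = 0`. -/
def counitHom : D.TensorBiproduct →ₐ[K] K :=
  lift (fun _ => 1) (fun _ => 0) rfl (fun _ _ => by simp) (fun _ _ => by simp)

theorem comulHom_grp (h : Γ) : comulHom D (grp D h) = grp D h ⊗ₜ[K] grp D h := by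
  rw [comulHom, lift_grp]

theorem comulHom_x (i : Fin θ) :
    comulHom D (x D i) = x D i ⊗ₜ[K] 1 + grp D (D.g i) ⊗ₜ[K] x D i := by
  rw [comulHom, lift_x]

theorem counitHom_grp (h : Γ) : counitHom D (grp D h) = 1 := by
  rw [counitHom, lift_grp]

theorem counitHom_x (i : Fin θ) : counitHom D (x D i) = 0 := by
  rw [counitHom, lift_x]

instance : Bialgebra K D.TensorBiproduct :=
  Bialgebra.ofAlgHom (comulHom D) (counitHom D)
    (algHom_ext
      (fun h => by simp [comulHom_grp])
      (fun i => by
        simp [comulHom_grp, comulHom_x, TensorProduct.add_tmul, TensorProduct.tmul_add,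
          Algebra.TensorProduct.one_def, add_assoc]))
    (algHom_ext
      (fun h => by simp [comulHom_grp, counitHom_grp])
      (fun i => by simp [comulHom_x, counitHom_grp, counitHom_x]))
    (algHom_ext
      (fun h => by simp [comulHom_grp, counitHom_grp])
      (fun i => by simp [comulHom_x, counitHom_x]))

theorem comul_grp (h : Γ) : comul (R := K) (grp D h) = grp D h ⊗ₜ[K] grp D h :=
  comulHom_grp D h

theorem comul_x (i : Fin θ) :
    comul (R := K) (x D i) = x D i ⊗ₜ[K] 1 + grp D (D.g i) ⊗ₜ[K] x D i :=
  comulHom_x D i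

theorem counit_grp (h : Γ) : counit (R := K) (grp D h) = 1 := counitHom_grp D h

theorem counit_x (i : Fin θ) : counit (R := K) (x D i) = 0 := counitHom_x D i

end TensorBiproduct

open TensorBiproduct

/-- The part `⊕_{n ≥ 2} T^n(W) # K[Γ]` of `T(W) # K[Γ]`. -/
def degreeGeTwo : Submodule K D.TensorBiproduct :=
  Submodule.span K {t | ∃ (l : List (Fin θ)) (h : Γ), 2 ≤ l.length ∧
    t = (l.map (x D)).prod * grp D h}

/-- The defining ideal of `B(W) # K[Γ]`, where `B(W)` is the Nichols algebra of `W`: the largest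
two-sided ideal and coideal of `T(W) # K[Γ]` contained in `⊕_{n ≥ 2} T^n(W) # K[Γ]`. -/
def nicholsIdeal : Ideal D.TensorBiproduct :=
  sSup {I | I.IsTwoSided ∧ (I.restrictScalars K).IsCoideal ∧
    I.restrictScalars K ≤ D.degreeGeTwo}

instance : D.nicholsIdeal.IsTwoSided where
  mul_mem_of_left {a} b ha := by
    have h : D.nicholsIdeal ≤ Submodule.comap
        (LinearMap.toSpanSingleton D.TensorBiproduct D.TensorBiproduct b) D.nicholsIdeal := by
      refine sSup_le fun I hI y hy => ?_
      exact le_sSup (a := I) hI (hI.1.mul_mem_of_left b hy)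
    exact h ha

instance : (D.nicholsIdeal.restrictScalars K).IsCoideal where
  counit_eq_zero t ht := by
    have h : D.nicholsIdeal ≤ RingHom.ker (Bialgebra.counitAlgHom K D.TensorBiproduct) :=
      sSup_le fun I hI y hy => hI.2.1.counit_eq_zero hy
    exact h ht
  map_mkQ_comul_eq_zero t ht := by
    let π := Ideal.Quotient.mkₐ K D.nicholsIdeal
    have h : D.nicholsIdeal ≤ RingHom.ker ((Algebra.TensorProduct.map π π).comp
        (Bialgebra.comulAlgHom K D.TensorBiproduct)) := by
      refine sSup_le fun I hI y hy => ?_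
      have h1 := hI.2.1.map_mkQ_comul_eq_zero hy
      have hle : I.restrictScalars K ≤ D.nicholsIdeal.restrictScalars K := le_sSup (a := I) hI
      let f := (I.restrictScalars K).mapQ (D.nicholsIdeal.restrictScalars K) .id hle
      have h2 := congrArg (TensorProduct.map f f) h1
      rw [← LinearMap.comp_apply, ← TensorProduct.map_comp, map_zero] at h2
      exact h2
    exact h ht

/-- The Radford biproduct `A = B(W) # K[Γ]` of the Nichols algebra of `W` with `K[Γ]`. -/
abbrev Biproduct : Type _ := D.TensorBiproduct ⧸ D.nicholsIdeal

namespace Biproduct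

/-- The group element `h ∈ Γ` in `A`. -/
def grp (h : Γ) : D.Biproduct := Ideal.Quotient.mk _ (TensorBiproduct.grp D h)

/-- The generator `xᵢ` of `A`. -/
def x (i : Fin θ) : D.Biproduct := Ideal.Quotient.mk _ (TensorBiproduct.x D i)

/-- The sub-Hopf algebra `H = K[Γ]` of `A`, generated by the group elements. -/
def groupSubalgebra : Subalgebra K D.Biproduct := Algebra.adjoin K (Set.range (grp D))

/-- The subalgebra `A_s` of `A` generated by `x₁, …, x_s, g₁, …, g_s`. -/
def initialSubalgebra (s : ℕ) : Subalgebra K D.Biproduct :=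
  Algebra.adjoin K {t | ∃ j : Fin θ, j.val < s ∧ (t = x D j ∨ t = grp D (D.g j))}

/-- The monomial `x₁^{n₁} ⋯ x_θ^{n_θ}` of `A`. -/
def monomial (n : Fin θ → ℕ) : D.Biproduct := (List.ofFn fun j => x D j ^ n j).prod

end Biproduct

/-- Scalars `aᵢ` and `aᵢⱼ` (`i ≠ j`) defining a lifting of `B(W) # K[Γ]`. The value of `b i i` is
irrelevant. -/
structure LiftingScalars where
  a : Fin θ → K
  b : Fin θ → Fin θ → K
  b_symm : ∀ i j, i ≠ j → b j i = -((D.χ j (D.g i) : K)⁻¹ * b i j)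
  g_pow_ne_one : ∀ i, a i ≠ 0 → D.g i ^ D.r i ≠ 1
  χ_pow_eq_one : ∀ i, a i ≠ 0 → D.χ i ^ D.r i = 1
  g_mul_g_ne_one : ∀ i j, i ≠ j → b i j ≠ 0 → D.g i * D.g j ≠ 1
  χ_mul_χ_eq_one : ∀ i j, i ≠ j → b i j ≠ 0 → D.χ i * D.χ j = 1

namespace LiftingScalars

variable {D} (S : D.LiftingScalars)

/-- The relations `xᵢ^{rᵢ} = aᵢ (1 - gᵢ^{rᵢ})` and `xᵢ xⱼ = χⱼ(gᵢ) xⱼ xᵢ + aᵢⱼ (1 - gᵢ gⱼ)`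
for `i ≠ j`, written as elements of `T(W) # K[Γ]` that are to vanish. -/
inductive Relator : D.TensorBiproduct → Prop
  | power (i : Fin θ) : Relator (x D i ^ D.r i - S.a i • (1 - grp D (D.g i ^ D.r i)))
  | link (i j : Fin θ) (h : i ≠ j) : Relator (x D i * x D j -
      ((D.χ j (D.g i) : K) • (x D j * x D i) + S.b i j • (1 - grp D (D.g i * D.g j))))

/-- The two-sided ideal generated by the relations of the lifting. -/
def ideal : Ideal D.TensorBiproduct := (TwoSidedIdeal.span {t | S.Relator t}).asIdeal

instance : S.ideal.IsTwoSided := inferInstanceAs (TwoSidedIdeal.asIdeal _).IsTwoSided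

theorem relator_mem {t : D.TensorBiproduct} (h : S.Relator t) : t ∈ S.ideal :=
  TwoSidedIdeal.mem_asIdeal.mpr (TwoSidedIdeal.subset_span h)

theorem counit_relator {t : D.TensorBiproduct} (h : S.Relator t) : counit (R := K) t = 0 := by
  cases h with
  | power i =>
    have := D.two_le_r i
    simp [counit_grp, counit_x, zero_pow (show D.r i ≠ 0 by omega)]
  | link i j h => simp [counit_grp, counit_x]

/-- Each relator `t` is skew primitive: `Δ(t) = t ⊗ 1 + h ⊗ t` with `h ∈ Γ`. -/
theorem comul_relator {t : D.TensorBiproduct} (h : S.Relator t) :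
    ∃ k : Γ, comul (R := K) t = t ⊗ₜ[K] 1 + grp D k ⊗ₜ[K] t := by
  cases h with
  | power i =>
    refine ⟨D.g i ^ D.r i, ?_⟩
    have hg : ∀ n : ℕ, grp D (D.g i) ^ n = grp D (D.g i ^ n) := by
      intro n
      induction n with
      | zero => simp [grp_one]
      | succ n ih => rw [pow_succ, ih, ← grp_mul, ← pow_succ]
    have h1 := add_pow_eq_of_isPrimitiveRoot (D.isPrimitiveRoot i) (D.two_le_r i)
      (x D i ⊗ₜ[K] (1 : D.TensorBiproduct)) (grp D (D.g i) ⊗ₜ[K] x D i) (by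
        simp only [Algebra.TensorProduct.tmul_mul_tmul, mul_one, one_mul, grp_mul_x,
          TensorProduct.smul_tmul'])
    rw [Algebra.TensorProduct.tmul_pow, Algebra.TensorProduct.tmul_pow, one_pow, hg] at h1
    rw [map_sub, map_smul, map_sub, Bialgebra.comul_pow, comul_x, h1, Bialgebra.comul_one,
      comul_grp, Algebra.TensorProduct.one_def]
    simp only [TensorProduct.sub_tmul, TensorProduct.tmul_sub, TensorProduct.tmul_smul,
      ← TensorProduct.smul_tmul', smul_sub]
    abel
  | link i j h =>
    refine ⟨D.g i * D.g j, ?_⟩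
    have hχ : (D.χ j (D.g i) : K) * (D.χ i (D.g j) : K) = 1 := by
      have := congrArg Units.val (D.χ_mul_χ i j h)
      rw [mul_comm]
      simpa using this
    rw [map_sub, map_add, map_smul, map_smul, map_sub, Bialgebra.comul_mul, Bialgebra.comul_mul,
      comul_x, comul_x, Bialgebra.comul_one, comul_grp, Algebra.TensorProduct.one_def]
    simp only [mul_add, add_mul, Algebra.TensorProduct.tmul_mul_tmul, mul_one, one_mul, grp_mul_x,
      ← grp_mul, mul_comm (D.g j) (D.g i), TensorProduct.sub_tmul, TensorProduct.tmul_sub,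
      TensorProduct.add_tmul, TensorProduct.tmul_add, TensorProduct.tmul_smul,
      ← TensorProduct.smul_tmul', smul_sub, smul_add, smul_smul, hχ, one_smul]
    abel

theorem ideal_le_ker {B : Type*} [Ring B] [Algebra K B] (f : D.TensorBiproduct →ₐ[K] B)
    (hf : ∀ t, S.Relator t → f t = 0) : ∀ t ∈ S.ideal, f t = 0 := by
  intro t ht
  have h : TwoSidedIdeal.span {t | S.Relator t} ≤ TwoSidedIdeal.ker f :=
    TwoSidedIdeal.span_le.mpr fun t ht => (TwoSidedIdeal.mem_ker f).mpr (hf t ht)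
  exact (TwoSidedIdeal.mem_ker f).mp (h (TwoSidedIdeal.mem_asIdeal.mp ht))

instance : (S.ideal.restrictScalars K).IsCoideal where
  counit_eq_zero t ht := S.ideal_le_ker (Bialgebra.counitAlgHom K D.TensorBiproduct)
    (fun _ h => S.counit_relator h) t ht
  map_mkQ_comul_eq_zero t ht := by
    let π := Ideal.Quotient.mkₐ K S.ideal
    refine S.ideal_le_ker ((Algebra.TensorProduct.map π π).comp
      (Bialgebra.comulAlgHom K D.TensorBiproduct)) (fun t h => ?_) t ht
    obtain ⟨k, hk⟩ := S.comul_relator h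
    have hπ : π t = 0 := Ideal.Quotient.eq_zero_iff_mem.mpr (S.relator_mem h)
    simp [hk, hπ]

/-- The lifting `B = A(aᵢ, aᵢⱼ)` of `B(W) # K[Γ]`: the quotient of `T(W) # K[Γ]` by the relations
of the lifting, that is, the algebra generated by `Γ` and `x₁, …, x_θ` with relations those of `Γ`,
`h xᵢ = χᵢ(h) xᵢ h`, `xᵢ^{rᵢ} = aᵢ (1 - gᵢ^{rᵢ})` and
`xᵢ xⱼ = χⱼ(gᵢ) xⱼ xᵢ + aᵢⱼ (1 - gᵢ gⱼ)` for `i ≠ j`, with group-like `h ∈ Γ` and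
`Δ(xᵢ) = xᵢ ⊗ 1 + gᵢ ⊗ xᵢ`. -/
abbrev Lifting : Type _ := D.TensorBiproduct ⧸ S.ideal

end LiftingScalars

end QuantumLinearSpace

end

/-!
Let `x` be a `(1, g)`-skew primitive generator of `A` and `γ` a cocycle that is trivial over `K[Γ]`.
Then the product with `x` in `A^γ` is
`y ·_γ x = y x + ∑ (γ(y₁ ⊗ x) y₂ - γ(y₂ ⊗ x) y₁ g)`.
Taking `y = xᵢ^n` and `y = xᵢ`, one reads off that the generators of `A^γ` satisfy the relations of
the lifting `B` with the scalars `γ(xᵢ^{rᵢ-1} ⊗ xᵢ)` and `γ(xᵢ ⊗ xⱼ)`, so there is a bialgebra map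
`B → A^γ`. Since comultiplication respects the filtration of `A` by word length, the correction term
has lower degree than `y x`. The monomials `h x₁^{n₁} ⋯ x_θ^{n_θ}` with `nᵢ < rᵢ` span `B` and
form a basis of `A`, and the map from `A` to `B` and on to `A^γ = A` which starts by matching
monomials is therefore unitriangular, hence bijective.

In `A` the relations of the lifting with zero scalars hold because they generate a biideal in
degrees at least two, which the Nichols ideal contains. The monomials are linearly independent in
`A` because iterating the skew derivations `∂ᵢ` and projecting to `K[Γ]` gives functionals
separating them: `∂ᵢ` lowers `nᵢ` by one, with a coefficient which up to a unit is
`1 + q + ⋯ + q^{nᵢ-1}` for `q = χᵢ(gᵢ)⁻¹`, and this is nonzero when `0 < nᵢ < rᵢ`.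
-/

noncomputable section

theorem sub_single_add_single {ι : Type*} [DecidableEq ι] {n : ι → ℕ} {i : ι} (hi : n i ≠ 0) :
    n - Pi.single i 1 + Pi.single i 1 = n := by
  refine tsub_add_cancel_of_le fun j => ?_
  rcases eq_or_ne j i with rfl | hj
  · rw [Pi.single_eq_same]
    exact Nat.one_le_iff_ne_zero.mpr hi
  · rw [Pi.single_eq_of_ne hj]
    exact Nat.zero_le _

theorem bijective_of_sub_mem_filtration {R M : Type*} [Ring R] [AddCommGroup M] [Module R M]
    (F : ℕ → Submodule R M) (hbot : F 0 = ⊥) (htop : ∀ x, ∃ k, x ∈ F k) (T : M →ₗ[R] M)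
    (hT : ∀ k, ∀ x ∈ F (k + 1), T x - x ∈ F k) : Function.Bijective T := by
  constructor
  · refine (injective_iff_map_eq_zero T).mpr fun x hx => ?_
    obtain ⟨k, hk⟩ := htop x
    induction k with
    | zero => rwa [hbot] at hk
    | succ k ih => exact ih (by simpa only [hx, zero_sub, neg_mem_iff] using hT k x hk)
  · intro y
    obtain ⟨k, hk⟩ := htop y
    induction k generalizing y with
    | zero =>
      rw [hbot, Submodule.mem_bot] at hk
      exact ⟨0, by rw [map_zero, hk]⟩
    | succ k ih =>
      obtain ⟨z, hz⟩ := ih (T y - y) (hT k y hk)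
      exact ⟨y - z, by rw [map_sub, hz, sub_sub_cancel]⟩

namespace TwoCocycle

/-! ### Twisted multiplication by a skew primitive element -/

section Slice

variable {K A E : Type*} [Field K] [Ring A] [Bialgebra K A] [Ring E] [Algebra K E]

/-- The linear map `y ↦ X (y ⊗ a)`, regarded as an element of the convolution algebra of `A`. -/
def slice (X : WithConv (A ⊗[K] A →ₗ[K] E)) (a : A) : WithConv (A →ₗ[K] E) :=
  toConv (X.ofConv ∘ₗ (TensorProduct.mk K A A).flip a)

theorem slice_one (a : A) : slice (1 : WithConv (A ⊗[K] A →ₗ[K] E)) a =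
    counit (R := K) a • (1 : WithConv (A →ₗ[K] E)) := by
  ext y
  simp [slice, Algebra.smul_def]

theorem slice_scal (w : WithConv (A ⊗[K] A →ₗ[K] K)) (a : A) :
    slice (scal _ E w) a = scal _ E (slice w a) := rfl

theorem slice_mul' (a : A) :
    slice (toConv (LinearMap.mul' K A)) a = toConv (LinearMap.mulRight K a) := rfl

theorem mul'_map_tensorTensorTensorComm (X Y : WithConv (A ⊗[K] A →ₗ[K] E)) (y a b : A) :
    LinearMap.mul' K E (TensorProduct.map X.ofConv Y.ofConv
      (TensorProduct.AlgebraTensorModule.tensorTensorTensorComm K K K K A A A A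
        (comul y ⊗ₜ (a ⊗ₜ b)))) = (slice X a * slice Y b) y := by
  rw [LinearMap.convMul_apply]
  induction comul (R := K) y with
  | zero => simp
  | tmul => rfl
  | add t t' ht ht' => simp only [TensorProduct.add_tmul, map_add, ht, ht']

theorem slice_convMul_of_isGroupLikeElem (X Y : WithConv (A ⊗[K] A →ₗ[K] E)) {g : A}
    (hg : IsGroupLikeElem K g) : slice (X * Y) g = slice X g * slice Y g := by
  ext y
  rw [← mul'_map_tensorTensorTensorComm, ← hg.comul_eq_tmul_self]
  rfl

theorem slice_convMul_of_comul_eq (X Y : WithConv (A ⊗[K] A →ₗ[K] E)) {g x : A}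
    (hx : comul (R := K) x = x ⊗ₜ[K] 1 + g ⊗ₜ[K] x) :
    slice (X * Y) x = slice X x * slice Y 1 + slice X g * slice Y x := by
  ext y
  change _ = (slice X x * slice Y 1) y + (slice X g * slice Y x) y
  rw [← mul'_map_tensorTensorTensorComm, ← mul'_map_tensorTensorTensorComm, ← map_add, ← map_add,
    ← map_add, ← TensorProduct.tmul_add, ← hx]
  rfl

end Slice

variable {K A : Type*} [Field K] [Ring A] [Bialgebra K A] {γ : TwoCocycle K A} {g x : A}

theorem slice_unit_eq_one (h : ∀ y, γ.toLinearMap (y ⊗ₜ g) = counit (R := K) y) :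
    slice γ.unit.val g = 1 := by
  ext y
  exact h y

theorem slice_unit_inv_eq_one (hg : IsGroupLikeElem K g) (hγ : slice γ.unit.val g = 1) :
    slice γ.unit⁻¹.val g = 1 := by
  have h := slice_convMul_of_isGroupLikeElem γ.unit.val γ.unit⁻¹.val hg
  rwa [Units.mul_inv, slice_one, hg.counit_eq_one, one_smul, hγ, one_mul, eq_comm] at h

theorem slice_unit_inv_eq_neg (hx : comul (R := K) x = x ⊗ₜ[K] 1 + g ⊗ₜ[K] x)
    (hε : counit (R := K) x = 0) (hγ : slice γ.unit.val g = 1) :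
    slice γ.unit⁻¹.val x = -slice γ.unit.val x := by
  have h := slice_convMul_of_comul_eq γ.unit.val γ.unit⁻¹.val hx
  rw [Units.mul_inv, slice_one, hε, zero_smul, hγ, one_mul,
    slice_unit_inv_eq_one .one (slice_unit_eq_one γ.map_tmul_one), mul_one] at h
  exact eq_neg_of_add_eq_zero_right h.symm

theorem twistedMul_tmul_of_isGroupLikeElem (hg : IsGroupLikeElem K g)
    (hγ : slice γ.unit.val g = 1) (y : A) : γ.twistedMul (y ⊗ₜ g) = y * g := by
  have h : slice γ.twistedMulConv g = toConv (LinearMap.mulRight K g) := by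
    rw [twistedMulConv, slice_convMul_of_isGroupLikeElem _ _ hg,
      slice_convMul_of_isGroupLikeElem _ _ hg, slice_scal, slice_scal, hγ,
      slice_unit_inv_eq_one hg hγ, map_one, one_mul, mul_one, slice_mul']
  exact congrArg (fun f : WithConv (A →ₗ[K] A) => f y) h

variable (γ) in
/-- The map `a ⊗ b ↦ γ(a ⊗ x) b - γ(b ⊗ x) a g`, by which the products with a skew primitive element
`x` before and after twisting by `γ` differ. -/
def skewCorrection (g x : A) : A ⊗[K] A →ₗ[K] A :=
  (TensorProduct.lid K A).toLinearMap ∘ₗ (slice γ.unit.val x).ofConv.rTensor A -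
    (TensorProduct.rid K A).toLinearMap ∘ₗ
      TensorProduct.map (LinearMap.mulRight K g) (slice γ.unit.val x).ofConv

theorem skewCorrection_tmul (a b : A) : γ.skewCorrection g x (a ⊗ₜ b) =
    γ.toLinearMap (a ⊗ₜ x) • b - γ.toLinearMap (b ⊗ₜ x) • (a * g) := rfl

theorem skewCorrection_comul (y : A) : γ.skewCorrection g x (comul y) =
    (scal A A (slice γ.unit.val x) * toConv (LinearMap.id : A →ₗ[K] A) -
      toConv (LinearMap.mulRight K g) * scal A A (slice γ.unit.val x)) y := by
  change _ = (scal A A (slice γ.unit.val x) * toConv (LinearMap.id : A →ₗ[K] A)) y -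
    (toConv (LinearMap.mulRight K g) * scal A A (slice γ.unit.val x)) y
  rw [LinearMap.convMul_apply, LinearMap.convMul_apply]
  induction comul (R := K) y with
  | zero => simp only [map_zero, sub_zero]
  | tmul a b =>
    exact congrArg₂ (· - ·) (Algebra.smul_def _ b)
      ((Algebra.smul_def _ (a * g)).trans (Algebra.commutes _ _))
  | add t t' ht ht' => rw [map_add, ht, ht', map_add, map_add, map_add, map_add, add_sub_add_comm]

theorem twistedMul_tmul_of_comul_eq (hg : IsGroupLikeElem K g)
    (hx : comul (R := K) x = x ⊗ₜ[K] 1 + g ⊗ₜ[K] x) (hε : counit (R := K) x = 0)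
    (hγ : slice γ.unit.val g = 1) (y : A) :
    γ.twistedMul (y ⊗ₜ x) = y * x + γ.skewCorrection g x (comul y) := by
  have hneg : scal A A (-slice γ.unit.val x) = -scal A A (slice γ.unit.val x) := by
    ext y
    simp [scal]
  have h : slice γ.twistedMulConv x = toConv (LinearMap.mulRight K x) +
      (scal A A (slice γ.unit.val x) * toConv (LinearMap.id : A →ₗ[K] A) -
        toConv (LinearMap.mulRight K g) * scal A A (slice γ.unit.val x)) := by
    rw [twistedMulConv, slice_convMul_of_comul_eq _ _ hx, slice_convMul_of_comul_eq _ _ hx,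
      slice_convMul_of_isGroupLikeElem _ _ hg]
    simp only [slice_scal, slice_mul', hγ, slice_unit_inv_eq_neg hx hε hγ, map_one, hneg, mul_one,
      slice_unit_inv_eq_one .one (slice_unit_eq_one γ.map_tmul_one), one_mul,
      LinearMap.mulRight_one]
    rw [mul_neg, ← sub_eq_add_neg, add_comm (_ * _), add_sub_assoc]
  rw [skewCorrection_comul]
  exact congrArg (fun f : WithConv (A →ₗ[K] A) => f y) h

end TwoCocycle

namespace QuantumLinearSpace

/-! ### Words and straightening -/

/-- The nondecreasing word in which the letter `j` occurs `n j` times. -/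
def sortedWord {θ : ℕ} (n : Fin θ → ℕ) : List (Fin θ) :=
  (List.ofFn fun j => List.replicate (n j) j).flatten

theorem count_sortedWord {θ : ℕ} (n : Fin θ → ℕ) (i : Fin θ) : (sortedWord n).count i = n i := by
  rw [sortedWord, List.count_flatten, List.map_ofFn, List.sum_ofFn, Finset.sum_eq_single i]
  · simp
  · intro j _ hj
    simp [List.count_replicate, hj]
  · simp

theorem perm_sortedWord_count {θ : ℕ} (l : List (Fin θ)) : l.Perm (sortedWord fun j => l.count j) :=
  List.perm_iff_count.mpr fun i => (count_sortedWord (fun j => l.count j) i).symm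

variable {K Γ : Type*} [Field K] [CommGroup Γ] {θ : ℕ} (D : QuantumLinearSpace K Γ θ)

section Words

open TensorBiproduct

/-- The word `x_{l₁} ⋯ x_{l_k}` in `T(W) # K[Γ]`. -/
def word (l : List (Fin θ)) : D.TensorBiproduct := (l.map (x D)).prod

theorem word_nil : D.word [] = 1 := rfl

theorem word_cons (i : Fin θ) (l : List (Fin θ)) : D.word (i :: l) = x D i * D.word l :=
  List.prod_cons

theorem word_append (l l' : List (Fin θ)) : D.word (l ++ l') = D.word l * D.word l' := by
  rw [word, List.map_append, List.prod_append, word, word]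

theorem word_replicate (n : ℕ) (i : Fin θ) : D.word (List.replicate n i) = x D i ^ n := by
  rw [word, List.map_replicate, List.prod_replicate]

theorem word_sortedWord (n : Fin θ → ℕ) :
    D.word (sortedWord n) = (List.ofFn fun j => x D j ^ n j).prod := by
  rw [word, sortedWord, List.map_flatten, List.prod_flatten, List.map_map, List.map_ofFn]
  congr 2
  funext j
  exact D.word_replicate (n j) j

theorem grp_mul_word (h : Γ) (l : List (Fin θ)) :
    grp D h * D.word l = (((l.map fun i => D.χ i h).prod : Kˣ) : K) • (D.word l * grp D h) := by
  induction l with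
  | nil => simp only [word_nil, mul_one, one_mul, List.map_nil, List.prod_nil, Units.val_one,
      one_smul]
  | cons i l ih => rw [word_cons, ← mul_assoc, grp_mul_x, smul_mul_assoc, mul_assoc, ih,
      mul_smul_comm, smul_smul, List.map_cons, List.prod_cons, Units.val_mul, mul_assoc]

theorem word_mul_grp (l : List (Fin θ)) (h : Γ) :
    D.word l * grp D h = (((l.map fun i => D.χ i h).prod⁻¹ : Kˣ) : K) • (grp D h * D.word l) := by
  rw [grp_mul_word, smul_smul, Units.inv_mul, one_smul]

section Straightening

variable {E : Type*} [Ring E] [Algebra K E] (π : D.TensorBiproduct →ₐ[K] E)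

/-- The span of the images of the elements `h x_{l₁} ⋯ x_{l_m}` with `h` in the submonoid `H`, all
`l_i < s`, and `m < k`. The strict bound makes the `0`-th term of this filtration zero. -/
def wordSpan (H : Submonoid Γ) (s k : ℕ) : Submodule K E :=
  Submodule.span K {t | ∃ h ∈ H, ∃ l : List (Fin θ), (∀ j ∈ l, j.val < s) ∧ l.length < k ∧
    t = π (grp D h * D.word l)}

/-- The span of the images of the elements `h x₁^{n₁} ⋯ x_s^{n_s}` of degree less than `k`, with
`h` in the submonoid `H` and `n_j < r_j` for all `j`. -/
def monomialSpan (H : Submonoid Γ) (s k : ℕ) : Submodule K E :=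
  Submodule.span K {t | ∃ h ∈ H, ∃ n : Fin θ → ℕ, (∀ j, n j < D.r j) ∧
    (∀ j : Fin θ, s ≤ j.val → n j = 0) ∧ (sortedWord n).length < k ∧
    t = π (grp D h * D.word (sortedWord n))}

variable {D} {H : Submonoid Γ} {s : ℕ}

theorem mem_wordSpan {k : ℕ} {h : Γ} (hh : h ∈ H) {l : List (Fin θ)} (hl : ∀ j ∈ l, j.val < s)
    (hk : l.length < k) : π (grp D h * D.word l) ∈ D.wordSpan π H s k :=
  Submodule.subset_span ⟨h, hh, l, hl, hk, rfl⟩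

theorem word_mem_wordSpan {k : ℕ} {l : List (Fin θ)} (hl : ∀ j ∈ l, j.val < s)
    (hk : l.length < k) : π (D.word l) ∈ D.wordSpan π H s k := by
  simpa only [grp_one, one_mul] using mem_wordSpan π H.one_mem hl hk

theorem grp_mem_wordSpan {h : Γ} (hh : h ∈ H) : π (grp D h) ∈ D.wordSpan π H s 1 := by
  simpa only [word_nil, mul_one] using
    mem_wordSpan π (s := s) hh (l := []) (fun _ hj => absurd hj List.not_mem_nil) zero_lt_one

theorem x_mem_wordSpan {i : Fin θ} (hi : i.val < s) : π (x D i) ∈ D.wordSpan π H s 2 := by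
  simpa only [word_cons, word_nil, mul_one] using
    word_mem_wordSpan π (H := H) (l := [i]) (fun j hj => List.mem_singleton.mp hj ▸ hi) one_lt_two

theorem one_mem_wordSpan : (1 : E) ∈ D.wordSpan π H s 1 := by
  simpa only [grp_one, map_one] using grp_mem_wordSpan π (s := s) H.one_mem

theorem wordSpan_zero : D.wordSpan π H s 0 = ⊥ :=
  Submodule.span_eq_bot.mpr fun _ ⟨_, _, _, _, hk, _⟩ => absurd hk (Nat.not_lt_zero _)

theorem wordSpan_mono {k k' : ℕ} (h : k ≤ k') : D.wordSpan π H s k ≤ D.wordSpan π H s k' :=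
  Submodule.span_mono fun _ ⟨g, hg, l, hl, hk, ht⟩ => ⟨g, hg, l, hl, hk.trans_le h, ht⟩

theorem monomialSpan_mono {k k' : ℕ} (h : k ≤ k') :
    D.monomialSpan π H s k ≤ D.monomialSpan π H s k' :=
  Submodule.span_mono fun _ ⟨g, hg, n, hn, hs, hk, ht⟩ => ⟨g, hg, n, hn, hs, hk.trans_le h, ht⟩

theorem wordSpan_mul_le {a b c : ℕ} (habc : a + b ≤ c + 1) :
    D.wordSpan π H s a * D.wordSpan π H s b ≤ D.wordSpan π H s c := by
  rw [wordSpan, wordSpan, Submodule.span_mul_span, Submodule.span_le]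
  rintro _ ⟨_, ⟨g, hg, l, hl, hla, rfl⟩, _, ⟨h, hh, m, hm, hmb, rfl⟩, rfl⟩
  have hmul : grp D g * D.word l * (grp D h * D.word m) =
      (((l.map fun i => D.χ i h).prod⁻¹ : Kˣ) : K) • (grp D (g * h) * D.word (l ++ m)) := by
    rw [mul_assoc, ← mul_assoc (D.word l), word_mul_grp, word_append, grp_mul, smul_mul_assoc,
      mul_smul_comm]
    simp only [mul_assoc]
  change π _ * π _ ∈ _
  rw [← map_mul, hmul, map_smul]
  refine Submodule.smul_mem _ _ (mem_wordSpan π (H.mul_mem hg hh) (fun j hj => ?_) ?_)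
  · exact (List.mem_append.mp hj).elim (hl j) (hm j)
  · rw [List.length_append]
    lia

theorem mul_mem_wordSpan {a b c : ℕ} (habc : a + b ≤ c + 1) {t u : E}
    (ht : t ∈ D.wordSpan π H s a) (hu : u ∈ D.wordSpan π H s b) :
    t * u ∈ D.wordSpan π H s c :=
  wordSpan_mul_le π habc (Submodule.mul_mem_mul ht hu)

variable (H s) in
/-- The union of the filtration `wordSpan π H s`. -/
def wordSubalgebra : Subalgebra K E where
  carrier := {t | ∃ k, t ∈ D.wordSpan π H s k}
  mul_mem' := fun ⟨a, ha⟩ ⟨b, hb⟩ => ⟨a + b, mul_mem_wordSpan π (Nat.le_succ _) ha hb⟩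
  add_mem' := fun ⟨a, ha⟩ ⟨b, hb⟩ => ⟨max a b, add_mem
    (wordSpan_mono π (le_max_left a b) ha) (wordSpan_mono π (le_max_right a b) hb)⟩
  algebraMap_mem' c := ⟨1, by
    rw [Algebra.algebraMap_eq_smul_one]
    exact Submodule.smul_mem _ c (one_mem_wordSpan π)⟩

theorem exists_mem_wordSpan (t : D.TensorBiproduct) : ∃ k, π t ∈ D.wordSpan π ⊤ θ k := by
  have hgen : ∀ u, π (TensorBiproduct.mk D (FreeAlgebra.ι K u)) ∈ wordSubalgebra π ⊤ θ := by
    rintro (h | i)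
    exacts [⟨1, grp_mem_wordSpan π (Submonoid.mem_top h)⟩, ⟨2, x_mem_wordSpan π i.isLt⟩]
  obtain ⟨a, rfl⟩ := RingQuot.mkAlgHom_surjective K D.TensorRel t
  have ha : a ∈ Algebra.adjoin K (Set.range (FreeAlgebra.ι K)) :=
    FreeAlgebra.adjoin_range_ι K _ ▸ Algebra.mem_top
  have hle : Algebra.adjoin K (Set.range (FreeAlgebra.ι K)) ≤
      (wordSubalgebra π ⊤ θ).comap (π.comp (TensorBiproduct.mk D)) :=
    Algebra.adjoin_le (Set.range_subset_iff.mpr hgen)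
  exact hle ha

theorem exists_sub_smul_word_mem_wordSpan_of_perm
    (hcomm : ∀ i j : Fin θ, i ≠ j → i.val < s → j.val < s →
      ∃ c : K, π (x D i * x D j) - c • π (x D j * x D i) ∈ D.wordSpan π H s 2)
    {l l' : List (Fin θ)} (hp : l.Perm l') (hl : ∀ j ∈ l, j.val < s) :
    ∃ c : K, π (D.word l) - c • π (D.word l') ∈ D.wordSpan π H s l.length := by
  induction hp with
  | nil => exact ⟨1, by rw [one_smul, sub_self]; exact zero_mem _⟩
  | @cons i l l' _ ih =>
    obtain ⟨hi, hl⟩ := List.forall_mem_cons.mp hl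
    obtain ⟨c, hc⟩ := ih hl
    refine ⟨c, ?_⟩
    rw [word_cons, word_cons, map_mul, map_mul, ← mul_smul_comm, ← mul_sub, List.length_cons]
    exact mul_mem_wordSpan π (by lia) (x_mem_wordSpan π hi) hc
  | swap i j l =>
    obtain ⟨hj, hi, hl⟩ := by simpa only [List.forall_mem_cons] using hl
    rcases eq_or_ne j i with rfl | hij
    · exact ⟨1, by rw [one_smul, sub_self]; exact zero_mem _⟩
    obtain ⟨c, hc⟩ := hcomm j i hij hj hi
    refine ⟨c, ?_⟩
    simp only [word_cons, ← mul_assoc, List.length_cons, map_mul] at hc ⊢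
    rw [← smul_mul_assoc, ← sub_mul]
    exact mul_mem_wordSpan π (by lia) hc (word_mem_wordSpan π hl l.length.lt_succ_self)
  | trans h₁ _ ih₁ ih₂ =>
    obtain ⟨c, hc⟩ := ih₁ hl
    obtain ⟨c', hc'⟩ := ih₂ fun j hj => hl j (h₁.mem_iff.mpr hj)
    refine ⟨c * c', ?_⟩
    have h := add_mem hc (Submodule.smul_mem _ c (h₁.length_eq ▸ hc'))
    rwa [smul_sub, smul_smul, sub_add_sub_cancel] at h

theorem word_mem_wordSpan_length_of_le_count
    (hcomm : ∀ i j : Fin θ, i ≠ j → i.val < s → j.val < s →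
      ∃ c : K, π (x D i * x D j) - c • π (x D j * x D i) ∈ D.wordSpan π H s 2)
    {l : List (Fin θ)} (hl : ∀ j ∈ l, j.val < s) {i : Fin θ} (hi : D.r i ≤ l.count i)
    (hpow : π (x D i ^ D.r i) ∈ D.wordSpan π H s (D.r i)) :
    π (D.word l) ∈ D.wordSpan π H s l.length := by
  obtain ⟨m, hm⟩ := (List.replicate_sublist_iff.mpr hi).exists_perm_append
  obtain ⟨c, hc⟩ := exists_sub_smul_word_mem_wordSpan_of_perm π hcomm hm hl
  have hms : ∀ j ∈ m, j.val < s := fun j hj => hl j (hm.mem_iff.mpr (List.mem_append_right _ hj))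
  have hlen : l.length = D.r i + m.length := by
    rw [hm.length_eq, List.length_append, List.length_replicate]
  have h : π (D.word (List.replicate (D.r i) i ++ m)) ∈ D.wordSpan π H s l.length := by
    rw [word_append, word_replicate, map_mul]
    exact mul_mem_wordSpan π (by lia) hpow (word_mem_wordSpan π hms m.length.lt_succ_self)
  exact (Submodule.sub_mem_iff_left _ (Submodule.smul_mem _ c h)).mp hc

theorem wordSpan_le_monomialSpan
    (hcomm : ∀ i j : Fin θ, i ≠ j → i.val < s → j.val < s →
      ∃ c : K, π (x D i * x D j) - c • π (x D j * x D i) ∈ D.wordSpan π H s 2)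
    (hpow : ∀ i : Fin θ, i.val < s → π (x D i ^ D.r i) ∈ D.wordSpan π H s (D.r i)) (k : ℕ) :
    D.wordSpan π H s k ≤ D.monomialSpan π H s k := by
  induction k with
  | zero => exact (wordSpan_zero π).trans_le bot_le
  | succ k ih =>
    refine Submodule.span_le.mpr ?_
    rintro _ ⟨h, hh, l, hl, hk, rfl⟩
    have lower : ∀ {t : E}, t ∈ D.wordSpan π H s l.length →
        π (grp D h) * t ∈ D.monomialSpan π H s (k + 1) := fun ht =>
      monomialSpan_mono π k.le_succ (ih (mul_mem_wordSpan π (by lia) (grp_mem_wordSpan π hh) ht))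
    rw [map_mul]
    by_cases hr : ∀ j, l.count j < D.r j
    · obtain ⟨c, hc⟩ :=
        exists_sub_smul_word_mem_wordSpan_of_perm π hcomm (perm_sortedWord_count l) hl
      have hsub := lower hc
      rw [mul_sub, mul_smul_comm, ← map_mul _ _ (D.word (sortedWord _))] at hsub
      have hmon : π (grp D h * D.word (sortedWord fun j => l.count j)) ∈
          D.monomialSpan π H s (k + 1) := Submodule.subset_span
        ⟨h, hh, _, hr, fun j hj => List.count_eq_zero.mpr fun hm => absurd (hl j hm) hj.not_gt,
          (perm_sortedWord_count l).length_eq ▸ hk, rfl⟩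
      exact (Submodule.sub_mem_iff_left _ (Submodule.smul_mem _ c hmon)).mp hsub
    · push Not at hr
      obtain ⟨i, hi⟩ := hr
      have hil : i ∈ l := List.count_pos_iff.mp ((pos_of_gt (D.two_le_r i)).trans_le hi)
      exact lower (word_mem_wordSpan_length_of_le_count π hcomm hl hi (hpow i (hl i hil)))

end Straightening

end Words

/-! ### Relations in the biproduct -/

section NicholsIdeal

open TensorBiproduct

theorem span_word_mul_grp_eq_top :
    Submodule.span K {t | ∃ (l : List (Fin θ)) (h : Γ), t = D.word l * grp D h} = ⊤ := by
  refine Submodule.eq_top_iff'.mpr fun t => ?_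
  obtain ⟨k, hk⟩ := exists_mem_wordSpan (AlgHom.id K D.TensorBiproduct) t
  refine Submodule.span_le.mpr ?_ hk
  rintro _ ⟨h, _, l, _, _, rfl⟩
  rw [AlgHom.id_apply, grp_mul_word]
  exact Submodule.smul_mem _ _ (Submodule.subset_span ⟨l, h, rfl⟩)

theorem word_mul_grp_mul_word_mul_grp (l m : List (Fin θ)) (h k : Γ) :
    D.word l * grp D h * (D.word m * grp D k) =
      (((m.map fun i => D.χ i h).prod : Kˣ) : K) • (D.word (l ++ m) * grp D (h * k)) := by
  rw [mul_assoc, ← mul_assoc (grp D h), grp_mul_word, smul_mul_assoc, mul_smul_comm, mul_assoc,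
    ← grp_mul, ← mul_assoc, word_append]

variable {D} in
theorem word_mul_grp_mem_degreeGeTwo {l : List (Fin θ)} (hl : 2 ≤ l.length) (h : Γ) :
    D.word l * grp D h ∈ D.degreeGeTwo :=
  Submodule.subset_span ⟨l, h, hl, rfl⟩

theorem top_mul_degreeGeTwo_le : ⊤ * D.degreeGeTwo ≤ D.degreeGeTwo := by
  rw [← span_word_mul_grp_eq_top, degreeGeTwo, Submodule.span_mul_span, Submodule.span_le]
  rintro _ ⟨_, ⟨l, h, rfl⟩, _, ⟨m, k, hm, rfl⟩, rfl⟩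
  change _ * (D.word m * grp D k) ∈ D.degreeGeTwo
  rw [word_mul_grp_mul_word_mul_grp]
  exact Submodule.smul_mem _ _ (word_mul_grp_mem_degreeGeTwo (by rw [List.length_append]; lia) _)

theorem degreeGeTwo_mul_top_le : D.degreeGeTwo * ⊤ ≤ D.degreeGeTwo := by
  rw [← span_word_mul_grp_eq_top, degreeGeTwo, Submodule.span_mul_span, Submodule.span_le]
  rintro _ ⟨_, ⟨l, h, hl, rfl⟩, _, ⟨m, k, rfl⟩, rfl⟩
  change D.word l * grp D h * _ ∈ D.degreeGeTwo
  rw [word_mul_grp_mul_word_mul_grp]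
  exact Submodule.smul_mem _ _ (word_mul_grp_mem_degreeGeTwo (by rw [List.length_append]; lia) _)

/-- The two-sided ideal `⊕_{n ≥ 2} T^n(W) # K[Γ]`. -/
def degreeGeTwoIdeal : TwoSidedIdeal D.TensorBiproduct :=
  TwoSidedIdeal.mk' D.degreeGeTwo (zero_mem _) add_mem neg_mem
    (fun ht => D.top_mul_degreeGeTwo_le (Submodule.mul_mem_mul Submodule.mem_top ht))
    (fun ht => D.degreeGeTwo_mul_top_le (Submodule.mul_mem_mul ht Submodule.mem_top))

variable {D} in
theorem mem_degreeGeTwoIdeal {t : D.TensorBiproduct} :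
    t ∈ D.degreeGeTwoIdeal ↔ t ∈ D.degreeGeTwo :=
  TwoSidedIdeal.mem_mk' ..

variable {D} in
theorem word_mem_degreeGeTwo {l : List (Fin θ)} (hl : 2 ≤ l.length) :
    D.word l ∈ D.degreeGeTwo := by
  simpa only [grp_one, mul_one] using word_mul_grp_mem_degreeGeTwo hl (1 : Γ)

instance : Zero D.LiftingScalars where
  zero :=
    { a _ := 0
      b _ _ := 0
      b_symm _ _ _ := by rw [mul_zero, neg_zero]
      g_pow_ne_one _ h := absurd rfl h
      χ_pow_eq_one _ h := absurd rfl h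
      g_mul_g_ne_one _ _ _ h := absurd rfl h
      χ_mul_χ_eq_one _ _ _ h := absurd rfl h }

theorem LiftingScalars.zero_a (i : Fin θ) : (0 : D.LiftingScalars).a i = 0 := rfl

theorem LiftingScalars.zero_b (i j : Fin θ) : (0 : D.LiftingScalars).b i j = 0 := rfl

variable {D} in
theorem mem_degreeGeTwo_of_relator {t : D.TensorBiproduct}
    (ht : (0 : D.LiftingScalars).Relator t) : t ∈ D.degreeGeTwo := by
  cases ht with
  | power i =>
    rw [LiftingScalars.zero_a, zero_smul, sub_zero, ← word_replicate]
    exact word_mem_degreeGeTwo ((D.two_le_r i).trans_eq List.length_replicate.symm)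
  | link i j _ =>
    rw [LiftingScalars.zero_b, zero_smul, add_zero]
    have hx : ∀ i j, x D i * x D j ∈ D.degreeGeTwo := fun i j => by
      simpa only [word_cons, word_nil, mul_one] using word_mem_degreeGeTwo (l := [i, j]) le_rfl
    exact sub_mem (hx i j) (Submodule.smul_mem _ _ (hx j i))

theorem ideal_zero_le_nicholsIdeal : (0 : D.LiftingScalars).ideal ≤ D.nicholsIdeal := by
  have hle : TwoSidedIdeal.span {t | (0 : D.LiftingScalars).Relator t} ≤ D.degreeGeTwoIdeal :=
    TwoSidedIdeal.span_le.mpr fun _ ht => mem_degreeGeTwoIdeal.mpr (mem_degreeGeTwo_of_relator ht)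
  exact le_sSup ⟨inferInstance, inferInstance, fun _ ht =>
    mem_degreeGeTwoIdeal.mp (hle (TwoSidedIdeal.mem_asIdeal.mp ht))⟩

variable {D} in
theorem map_eq_zero_of_mem_nicholsIdeal {E : Type*} [Ring E] [Algebra K E]
    (f : D.TensorBiproduct →ₐ[K] E) (hf : ∀ i j, f (x D i) * f (x D j) = 0) :
    ∀ t ∈ D.nicholsIdeal, f t = 0 := by
  have hdeg : D.degreeGeTwo ≤ LinearMap.ker f.toLinearMap := by
    refine Submodule.span_le.mpr ?_
    rintro _ ⟨l, h, hl, rfl⟩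
    match l, hl with
    | i :: j :: l, _ =>
      change f _ = 0
      simp only [List.map_cons, List.prod_cons, ← mul_assoc, map_mul, hf, zero_mul]
  have hker : D.nicholsIdeal ≤ RingHom.ker f := sSup_le fun I hI t ht => hdeg (hI.2.2 ht)
  exact fun t ht => hker ht

end NicholsIdeal

namespace Biproduct

/-- The quotient map `T(W) # K[Γ] → B(W) # K[Γ]`. -/
def proj : D.TensorBiproduct →ₐ[K] D.Biproduct := Ideal.Quotient.mkₐ K D.nicholsIdeal

theorem proj_grp (h : Γ) : proj D (TensorBiproduct.grp D h) = grp D h := rfl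

theorem proj_x (i : Fin θ) : proj D (TensorBiproduct.x D i) = x D i := rfl

theorem proj_surjective : Function.Surjective (proj D) := Ideal.Quotient.mkₐ_surjective K _

theorem proj_word_sortedWord (n : Fin θ → ℕ) : proj D (D.word (sortedWord n)) = monomial D n := by
  rw [word_sortedWord, map_list_prod, List.map_ofFn, monomial]
  simp only [Function.comp_def, map_pow, proj_x]

theorem grp_one : grp D 1 = 1 := congrArg (proj D) (TensorBiproduct.grp_one D)

theorem grp_mul (h k : Γ) : grp D (h * k) = grp D h * grp D k :=
  congrArg (proj D) (TensorBiproduct.grp_mul D h k)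

theorem grp_mul_x (h : Γ) (i : Fin θ) : grp D h * x D i = (D.χ i h : K) • (x D i * grp D h) :=
  congrArg (proj D) (TensorBiproduct.grp_mul_x D h i)

theorem x_mul_grp (h : Γ) (i : Fin θ) :
    x D i * grp D h = (D.χ i h : K)⁻¹ • (grp D h * x D i) := by
  rw [grp_mul_x, smul_smul, inv_mul_cancel₀ (Units.ne_zero _), one_smul]

theorem x_pow_mul_grp (i : Fin θ) (n : ℕ) (h : Γ) :
    x D i ^ n * grp D h = ((D.χ i h : K)⁻¹ ^ n) • (grp D h * x D i ^ n) := by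
  induction n with
  | zero => simp only [pow_zero, one_mul, mul_one, one_smul]
  | succ n ih =>
    rw [pow_succ, mul_assoc, x_mul_grp, mul_smul_comm, ← mul_assoc, ih, smul_mul_assoc, smul_smul,
      mul_assoc, ← pow_succ, ← pow_succ']

theorem x_pow_r (i : Fin θ) : x D i ^ D.r i = 0 := by
  have h := D.ideal_zero_le_nicholsIdeal (LiftingScalars.relator_mem 0 (.power i))
  rw [LiftingScalars.zero_a, zero_smul, sub_zero] at h
  exact Ideal.Quotient.eq_zero_iff_mem.mpr h

theorem x_mul_x {i j : Fin θ} (hij : i ≠ j) :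
    x D i * x D j = (D.χ j (D.g i) : K) • (x D j * x D i) := by
  have h := D.ideal_zero_le_nicholsIdeal (LiftingScalars.relator_mem 0 (.link i j hij))
  rw [LiftingScalars.zero_b, zero_smul, add_zero] at h
  exact Ideal.Quotient.eq.mpr h

theorem comul_grp (h : Γ) : comul (R := K) (grp D h) = grp D h ⊗ₜ[K] grp D h :=
  (congrArg (TensorProduct.map _ _) (TensorBiproduct.comul_grp D h)).trans rfl

theorem comul_x (i : Fin θ) :
    comul (R := K) (x D i) = x D i ⊗ₜ[K] 1 + grp D (D.g i) ⊗ₜ[K] x D i :=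
  (congrArg (TensorProduct.map _ _) (TensorBiproduct.comul_x D i)).trans
    ((map_add _ _ _).trans rfl)

theorem isGroupLikeElem_grp (h : Γ) : IsGroupLikeElem K (grp D h) :=
  ⟨TensorBiproduct.counit_grp D h, comul_grp D h⟩

theorem counit_x (i : Fin θ) : counit (R := K) (x D i) = 0 := TensorBiproduct.counit_x D i

theorem comul_x_pow (i : Fin θ) (n : ℕ) :
    comul (R := K) (x D i ^ n) = ∑ k ∈ Finset.range (n + 1), qBinom (D.χ i (D.g i) : K) n k •
      ((x D i ^ k * grp D (D.g i) ^ (n - k)) ⊗ₜ[K] (x D i ^ (n - k))) := by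
  rw [Bialgebra.comul_pow, comul_x, add_pow_eq_sum_qBinom (D.χ i (D.g i) : K)]
  · simp only [Algebra.TensorProduct.tmul_pow, Algebra.TensorProduct.tmul_mul_tmul, one_pow,
      one_mul]
  · simp only [Algebra.TensorProduct.tmul_mul_tmul, mul_one, one_mul, grp_mul_x,
      TensorProduct.smul_tmul']

/-! ### Skew derivations and linear independence of the monomials -/

/-- An algebra map from `T(W) # K[Γ]` under which products of two `xᵢ` vanish factors through the
biproduct. -/
def lift {E : Type*} [Ring E] [Algebra K E] (f : D.TensorBiproduct →ₐ[K] E)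
    (hf : ∀ i j, f (TensorBiproduct.x D i) * f (TensorBiproduct.x D j) = 0) :
    D.Biproduct →ₐ[K] E :=
  Ideal.Quotient.liftₐ D.nicholsIdeal f (map_eq_zero_of_mem_nicholsIdeal f hf)

/-- The projection `B(W) # K[Γ] → K[Γ]`. -/
def toGroupAlgebra : D.Biproduct →ₐ[K] MonoidAlgebra K Γ :=
  lift D (TensorBiproduct.lift (fun h => MonoidAlgebra.of K Γ h) (fun _ => 0) (map_one _)
    (map_mul _) fun _ _ => by rw [mul_zero, zero_mul, smul_zero])
    fun i j => by rw [TensorBiproduct.lift_x, zero_mul]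

theorem toGroupAlgebra_grp (h : Γ) : toGroupAlgebra D (grp D h) = MonoidAlgebra.of K Γ h :=
  TensorBiproduct.lift_grp ..

theorem toGroupAlgebra_x (i : Fin θ) : toGroupAlgebra D (x D i) = 0 :=
  TensorBiproduct.lift_x ..

/-- The representation `h ↦ diag(χᵢ(h), 1)`, `xᵢ ↦ E₁₂`, `xⱼ ↦ 0` for `j ≠ i`. -/
def matrixRep (i : Fin θ) : D.Biproduct →ₐ[K] Matrix (Fin 2) (Fin 2) K :=
  lift D (TensorBiproduct.lift (fun h => !![(D.χ i h : K), 0; 0, 1])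
    (fun j => !![0, if j = i then 1 else 0; 0, 0])
    (by simp [Matrix.one_fin_two]) (fun _ _ => by simp)
    fun h j => by rcases eq_or_ne j i with rfl | hj <;> simp [*])
    fun j k => by
      rw [TensorBiproduct.lift_x, TensorBiproduct.lift_x, Matrix.mul_fin_two]
      ext a b
      fin_cases a <;> fin_cases b <;> simp

theorem matrixRep_grp (i : Fin θ) (h : Γ) :
    matrixRep D i (grp D h) = !![(D.χ i h : K), 0; 0, 1] :=
  TensorBiproduct.lift_grp ..

theorem matrixRep_x (i j : Fin θ) :
    matrixRep D i (x D j) = !![0, if j = i then 1 else 0; 0, 0] :=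
  TensorBiproduct.lift_x ..

theorem matrixRep_one_one (i : Fin θ) (y : D.Biproduct) :
    matrixRep D i y 1 1 = counit (R := K) y := by
  let entry : D.Biproduct →ₗ[K] K :=
    Matrix.entryLinearMap K K 1 1 ∘ₗ (matrixRep D i).toLinearMap
  have hext : entry ∘ₗ (proj D).toLinearMap = counit (R := K) ∘ₗ (proj D).toLinearMap := by
    refine LinearMap.ext_on D.span_word_mul_grp_eq_top ?_
    rintro _ ⟨_ | ⟨j, l⟩, h, rfl⟩
    · change matrixRep D i (proj D _) 1 1 = counit (R := K) (proj D _)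
      rw [word_nil, one_mul, proj_grp, matrixRep_grp, (isGroupLikeElem_grp D h).counit_eq_one]
      rfl
    · change matrixRep D i (proj D _) 1 1 = counit (R := K) (proj D _)
      rw [word_cons, mul_assoc, map_mul, proj_x, map_mul, Bialgebra.counit_mul, counit_x, zero_mul,
        matrixRep_x, Matrix.mul_apply, Fin.sum_univ_two]
      simp
  obtain ⟨t, rfl⟩ := proj_surjective D y
  exact LinearMap.congr_fun hext t

/-- The linear functional with value `χᵢ(h)` on `h xᵢ` and `0` on all other monomials. -/
def xCoord (i : Fin θ) : D.Biproduct →ₗ[K] K :=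
  Matrix.entryLinearMap K K 0 1 ∘ₗ (matrixRep D i).toLinearMap

theorem xCoord_grp_mul (i : Fin θ) (h : Γ) (y : D.Biproduct) :
    xCoord D i (grp D h * y) = (D.χ i h : K) * xCoord D i y := by
  change matrixRep D i (_ * _) 0 1 = _ * matrixRep D i y 0 1
  rw [map_mul, matrixRep_grp, Matrix.mul_apply, Fin.sum_univ_two]
  simp

theorem xCoord_x_mul (i j : Fin θ) (y : D.Biproduct) :
    xCoord D i (x D j * y) = if j = i then counit (R := K) y else 0 := by
  change matrixRep D i (_ * _) 0 1 = _
  rw [map_mul, matrixRep_x, Matrix.mul_apply, Fin.sum_univ_two, ← matrixRep_one_one D i]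
  simp

/-- The skew derivation `y ↦ y₍₁₎ xCoord i y₍₂₎` attached to `xᵢ`. -/
def skewDer (i : Fin θ) : D.Biproduct →ₗ[K] D.Biproduct :=
  (TensorProduct.rid K D.Biproduct).toLinearMap ∘ₗ (xCoord D i).lTensor _ ∘ₗ comul

theorem skewDer_one (i : Fin θ) : skewDer D i 1 = 0 := by
  change TensorProduct.rid K _ ((xCoord D i).lTensor _ (comul (R := K) (1 : D.Biproduct))) = 0
  rw [Bialgebra.comul_one, Algebra.TensorProduct.one_def, LinearMap.lTensor_tmul,
    TensorProduct.rid_tmul]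
  change matrixRep D i 1 0 1 • (1 : D.Biproduct) = 0
  rw [map_one, Matrix.one_apply_ne zero_ne_one, zero_smul]

theorem skewDer_grp_mul (i : Fin θ) (h : Γ) (y : D.Biproduct) :
    skewDer D i (grp D h * y) = (D.χ i h : K) • (grp D h * skewDer D i y) := by
  have hmul : ∀ t : D.Biproduct ⊗[K] D.Biproduct,
      TensorProduct.rid K _ ((xCoord D i).lTensor _ (grp D h ⊗ₜ[K] grp D h * t)) =
        (D.χ i h : K) • (grp D h * TensorProduct.rid K _ ((xCoord D i).lTensor _ t)) := fun t => by
    induction t with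
    | zero => simp only [mul_zero, map_zero, smul_zero]
    | add t u ht hu => simp only [mul_add, map_add, smul_add, ht, hu]
    | tmul a b =>
      rw [Algebra.TensorProduct.tmul_mul_tmul, LinearMap.lTensor_tmul, LinearMap.lTensor_tmul,
        TensorProduct.rid_tmul, TensorProduct.rid_tmul, xCoord_grp_mul, mul_smul, mul_smul_comm]
  have h := hmul (comul (R := K) y)
  rwa [← comul_grp, ← Bialgebra.comul_mul] at h

theorem skewDer_x_mul (i j : Fin θ) (y : D.Biproduct) :
    skewDer D i (x D j * y) = x D j * skewDer D i y + if j = i then grp D (D.g i) * y else 0 := by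
  have hmul : ∀ t : D.Biproduct ⊗[K] D.Biproduct, TensorProduct.rid K _ ((xCoord D i).lTensor _
      ((x D j ⊗ₜ[K] 1 + grp D (D.g j) ⊗ₜ[K] x D j) * t)) =
        x D j * TensorProduct.rid K _ ((xCoord D i).lTensor _ t) + if j = i then
          grp D (D.g i) * TensorProduct.rid K _ ((counit (R := K)).lTensor _ t) else 0 := by
    intro t
    induction t with
    | zero => simp only [mul_zero, map_zero, ite_self, add_zero]
    | add t u ht hu =>
      simp only [mul_add, map_add, ht, hu]
      split_ifs <;> abel
    | tmul a b =>
      simp only [add_mul, Algebra.TensorProduct.tmul_mul_tmul, one_mul, map_add,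
        LinearMap.lTensor_tmul, TensorProduct.rid_tmul, xCoord_x_mul, mul_smul_comm]
      split_ifs with hj
      · rw [hj]
      · rw [zero_smul]
  have h := hmul (comul (R := K) y)
  rwa [← comul_x, ← Bialgebra.comul_mul, Coalgebra.lTensor_counit_comul, TensorProduct.rid_tmul,
    one_smul] at h

theorem skewDer_x_pow_mul_of_ne {i j : Fin θ} (hj : j ≠ i) (n : ℕ) (y : D.Biproduct) :
    skewDer D i (x D j ^ n * y) = x D j ^ n * skewDer D i y := by
  induction n with
  | zero => rw [pow_zero, one_mul, one_mul]
  | succ n ih => rw [pow_succ', mul_assoc, skewDer_x_mul, if_neg hj, ih, add_zero, mul_assoc]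

theorem skewDer_x_pow_mul_self {i : Fin θ} {y : D.Biproduct} (hy : skewDer D i y = 0) (n : ℕ) :
    skewDer D i (x D i ^ n * y) = (∑ k ∈ Finset.range n, (D.χ i (D.g i) : K)⁻¹ ^ k) •
      (grp D (D.g i) * (x D i ^ (n - 1) * y)) := by
  induction n with
  | zero => rw [pow_zero, one_mul, hy, Finset.sum_range_zero, zero_smul]
  | succ n ih =>
    have hx : x D i * (grp D (D.g i) * (x D i ^ (n - 1) * y)) =
        (D.χ i (D.g i) : K)⁻¹ • (grp D (D.g i) * (x D i ^ (n - 1 + 1) * y)) := by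
      rw [← mul_assoc, x_mul_grp, smul_mul_assoc, mul_assoc, ← mul_assoc (x D i), ← pow_succ']
    rw [pow_succ', mul_assoc, skewDer_x_mul, if_pos rfl, ih, mul_smul_comm, hx, smul_smul,
      Finset.sum_range_succ', pow_zero, add_smul, one_smul, Nat.add_sub_cancel, Finset.sum_mul]
    congr 1
    rcases n with - | n
    · simp only [Finset.sum_range_zero, zero_smul]
    · simp only [Nat.add_sub_cancel, pow_succ _ (_ : ℕ)]

theorem geom_sum_ne_zero_iff (i : Fin θ) {n : ℕ} (hn : n < D.r i) :
    ∑ k ∈ Finset.range n, (D.χ i (D.g i) : K)⁻¹ ^ k ≠ 0 ↔ n ≠ 0 := by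
  refine ⟨fun h hn => h (by rw [hn, Finset.sum_range_zero]), fun h0 h => ?_⟩
  have hgeom := geom_sum_mul ((D.χ i (D.g i) : K)⁻¹) n
  rw [h, zero_mul] at hgeom
  exact (D.isPrimitiveRoot i).inv.pow_ne_one_of_pos_of_lt h0 hn (sub_eq_zero.mp hgeom.symm)

/-- The product of the `xⱼ^{nⱼ}` over a list of indices. -/
def partialMonomial (L : List (Fin θ)) (n : Fin θ → ℕ) : D.Biproduct :=
  (L.map fun j => x D j ^ n j).prod

theorem partialMonomial_finRange (n : Fin θ → ℕ) :
    partialMonomial D (List.finRange θ) n = monomial D n := by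
  rw [partialMonomial, monomial, List.ofFn_eq_map]

theorem partialMonomial_cons (i : Fin θ) (L : List (Fin θ)) (n : Fin θ → ℕ) :
    partialMonomial D (i :: L) n = x D i ^ n i * partialMonomial D L n :=
  List.prod_cons

theorem partialMonomial_sub_single {i : Fin θ} {L : List (Fin θ)} (hi : i ∉ L) (n : Fin θ → ℕ) :
    partialMonomial D L (n - Pi.single i 1) = partialMonomial D L n := by
  refine congrArg List.prod (List.map_congr_left fun j hj => ?_)
  rw [Pi.sub_apply, Pi.single_eq_of_ne (ne_of_mem_of_not_mem hj hi), Nat.sub_zero]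

theorem skewDer_partialMonomial {i : Fin θ} {L : List (Fin θ)} (hL : L.Nodup) {n : Fin θ → ℕ}
    (hn : n i < D.r i) : ∃ c : K, (c ≠ 0 ↔ i ∈ L ∧ n i ≠ 0) ∧ skewDer D i (partialMonomial D L n) =
      c • (grp D (D.g i) * partialMonomial D L (n - Pi.single i 1)) := by
  induction L with
  | nil => exact ⟨0, by simp, (skewDer_one D i).trans (zero_smul K _).symm⟩
  | cons j L ih =>
    obtain ⟨hj, hL⟩ := List.nodup_cons.mp hL
    obtain ⟨c, hc, hder⟩ := ih hL
    rw [partialMonomial_cons, partialMonomial_cons]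
    rcases eq_or_ne j i with rfl | hji
    · have hc0 : c = 0 := not_not.mp fun h0 => hj (hc.mp h0).1
      rw [hc0, zero_smul] at hder
      refine ⟨_, (geom_sum_ne_zero_iff D j hn).trans (by simp), ?_⟩
      rw [skewDer_x_pow_mul_self D hder, partialMonomial_sub_single D hj, Pi.sub_apply,
        Pi.single_eq_same]
    · refine ⟨c * (D.χ j (D.g i) : K)⁻¹ ^ n j, ?_, ?_⟩
      · rw [mul_ne_zero_iff_right (pow_ne_zero _ (inv_ne_zero (Units.ne_zero _))), hc,
          List.mem_cons, or_iff_right hji.symm]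
      · rw [skewDer_x_pow_mul_of_ne D hji, hder, mul_smul_comm, ← mul_assoc, x_pow_mul_grp,
          smul_mul_assoc, smul_smul, mul_assoc, Pi.sub_apply, Pi.single_eq_of_ne hji, Nat.sub_zero]

theorem skewDer_grp_mul_monomial (i : Fin θ) (h : Γ) {n : Fin θ → ℕ} (hn : n i < D.r i) :
    ∃ c : K, (c ≠ 0 ↔ n i ≠ 0) ∧ skewDer D i (grp D h * monomial D n) =
      c • (grp D (h * D.g i) * monomial D (n - Pi.single i 1)) := by
  obtain ⟨c, hc, hder⟩ := skewDer_partialMonomial D (List.nodup_finRange θ) hn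
  refine ⟨(D.χ i h : K) * c, ?_, ?_⟩
  · rw [mul_ne_zero_iff_left (Units.ne_zero _), hc, and_iff_right (List.mem_finRange i)]
  · rw [skewDer_grp_mul, ← partialMonomial_finRange, ← partialMonomial_finRange, hder,
      mul_smul_comm, smul_smul, ← mul_assoc, ← grp_mul]

theorem toGroupAlgebra_monomial {n : Fin θ → ℕ} (hn : n ≠ 0) :
    toGroupAlgebra D (monomial D n) = 0 := by
  obtain ⟨i, hi⟩ := Function.ne_iff.mp hn
  rw [monomial, map_list_prod, List.map_ofFn]
  refine List.prod_eq_zero (List.mem_ofFn.mpr ⟨i, ?_⟩)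
  rw [Function.comp_apply, map_pow, toGroupAlgebra_x, zero_pow hi]

/-- Among the monomials `h x₁^{n₁} ⋯ x_θ^{n_θ}` with `n_j < r_j`, the functional `f` is nonzero
exactly on the one given by `h₀` and `n₀`. -/
def Separates (f : D.Biproduct →ₗ[K] K) (h₀ : Γ) (n₀ : Fin θ → ℕ) : Prop :=
  ∀ (h : Γ) (n : Fin θ → ℕ), (∀ j, n j < D.r j) →
    (f (grp D h * monomial D n) ≠ 0 ↔ h = h₀ ∧ n = n₀)

theorem exists_separates_zero (h₀ : Γ) : ∃ f, Separates D f h₀ 0 := by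
  classical
  refine ⟨Finsupp.lapply h₀ ∘ₗ (MonoidAlgebra.coeffLinearEquiv K).toLinearMap ∘ₗ
    (toGroupAlgebra D).toLinearMap, fun h n _ => ?_⟩
  change (toGroupAlgebra D (grp D h * monomial D n)).coeff h₀ ≠ 0 ↔ _
  rw [map_mul, toGroupAlgebra_grp]
  rcases eq_or_ne n 0 with rfl | hn
  · simp [monomial, Finsupp.single_apply]
  · simp [toGroupAlgebra_monomial D hn, hn]

variable {D} in
theorem Separates.comp_skewDer {f : D.Biproduct →ₗ[K] K} {h₀ : Γ} {n₀ : Fin θ → ℕ} {i : Fin θ}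
    (hf : Separates D f (h₀ * D.g i) n₀) :
    Separates D (f ∘ₗ skewDer D i) h₀ (n₀ + Pi.single i 1) := by
  intro h n hn
  obtain ⟨c, hc, hder⟩ := skewDer_grp_mul_monomial D i h (hn i)
  rw [LinearMap.comp_apply, hder, map_smul, smul_eq_mul, mul_ne_zero_iff, hc,
    hf _ (n - Pi.single i 1) fun j => (Nat.sub_le _ _).trans_lt (hn j), mul_left_inj]
  have hn₀ : n i ≠ 0 ∧ n - Pi.single i 1 = n₀ ↔ n = n₀ + Pi.single i 1 := by
    constructor
    · rintro ⟨hi, rfl⟩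
      exact (sub_single_add_single hi).symm
    · rintro rfl
      simp
  rw [← hn₀]
  tauto

theorem exists_separates (h₀ : Γ) (n₀ : Fin θ → ℕ) : ∃ f, Separates D f h₀ n₀ := by
  induction n₀ using WellFoundedLT.induction generalizing h₀ with
  | ind n₀ ih =>
    rcases eq_or_ne n₀ 0 with rfl | hn₀
    · exact exists_separates_zero D h₀
    obtain ⟨i, hi⟩ := Function.ne_iff.mp hn₀
    have hadd : n₀ - Pi.single i 1 + Pi.single i 1 = n₀ := sub_single_add_single hi
    have hlt : n₀ - Pi.single i 1 < n₀ :=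
      (lt_add_of_pos_right _ (Pi.single_pos.mpr Nat.one_pos)).trans_eq hadd
    obtain ⟨f, hf⟩ := ih _ hlt (h₀ * D.g i)
    exact ⟨_, hadd ▸ hf.comp_skewDer⟩

theorem linearIndependent_grp_mul_monomial :
    LinearIndependent K fun p : Γ × (∀ j, Fin (D.r j)) =>
      grp D p.1 * monomial D fun j => p.2 j := by
  refine linearIndependent_iff'.mpr fun s c hc p hp => ?_
  obtain ⟨f, hf⟩ := exists_separates D p.1 fun j => p.2 j
  have hne := (hf _ _ fun j => (p.2 j).isLt).mpr ⟨rfl, rfl⟩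
  have hzero : ∀ q, q ≠ p → f (grp D q.1 * monomial D fun j => q.2 j) = 0 := fun q hq => by
    by_contra h0
    obtain ⟨h1, h2⟩ := (hf _ _ fun j => (q.2 j).isLt).mp h0
    exact hq (Prod.ext h1 (funext fun j => Fin.ext (congrFun h2 j)))
  have hsum := congrArg f hc
  rw [map_sum, map_zero, Finset.sum_eq_single_of_mem p hp fun q _ hq => by
    rw [map_smul, hzero q hq, smul_zero], map_smul, smul_eq_mul] at hsum
  exact (mul_eq_zero.mp hsum).resolve_right hne

end Biproduct

variable {D}

section SpanningSets

open TensorBiproduct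

variable {E : Type*} [Ring E] [Algebra K E] {π : D.TensorBiproduct →ₐ[K] E}

theorem span_grp_mul_sortedWord_eq_top (hπ : Function.Surjective π)
    (h : ∀ k, D.wordSpan π ⊤ θ k ≤ D.monomialSpan π ⊤ θ k) :
    Submodule.span K (Set.range fun p : Γ × (∀ j, Fin (D.r j)) =>
      π (grp D p.1 * D.word (sortedWord fun j => p.2 j))) = ⊤ := by
  refine Submodule.eq_top_iff'.mpr (hπ.forall.mpr fun t => ?_)
  obtain ⟨k, hk⟩ := exists_mem_wordSpan π t
  refine Submodule.span_mono ?_ (h k hk)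
  rintro _ ⟨h, _, n, hn, _, _, rfl⟩
  exact ⟨(h, fun j => ⟨n j, hn j⟩), rfl⟩

end SpanningSets

namespace Biproduct

theorem wordSpan_proj_le_monomialSpan (H : Submonoid Γ) (s k : ℕ) :
    D.wordSpan (proj D) H s k ≤ D.monomialSpan (proj D) H s k := by
  refine wordSpan_le_monomialSpan (proj D) (fun i j hij _ _ => ⟨D.χ j (D.g i), ?_⟩)
    (fun i _ => ?_) k
  · rw [map_mul, map_mul, proj_x, proj_x, x_mul_x D hij, sub_self]
    exact zero_mem _
  · rw [map_pow, proj_x, x_pow_r]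
    exact zero_mem _

variable (D) in
/-- The basis of `B(W) # K[Γ]` formed by the monomials `h x₁^{n₁} ⋯ x_θ^{n_θ}` with `n_j < r_j`. -/
def monomialBasis : Module.Basis (Γ × (∀ j, Fin (D.r j))) K D.Biproduct :=
  .mk (linearIndependent_grp_mul_monomial D) <| by
    simpa only [map_mul, proj_grp, proj_word_sortedWord] using
      (span_grp_mul_sortedWord_eq_top (proj_surjective D)
        (wordSpan_proj_le_monomialSpan ⊤ θ)).ge

theorem monomialBasis_apply (p : Γ × (∀ j, Fin (D.r j))) : monomialBasis D p =
    proj D (TensorBiproduct.grp D p.1 * D.word (sortedWord fun j => p.2 j)) := by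
  rw [monomialBasis, Module.Basis.mk_apply, map_mul, proj_grp, proj_word_sortedWord]

theorem initialSubalgebra_le_wordSubalgebra (s : ℕ) : initialSubalgebra D s ≤
    wordSubalgebra (proj D) (Submonoid.closure {k | ∃ j : Fin θ, j.val < s ∧ k = D.g j}) s := by
  refine Algebra.adjoin_le ?_
  rintro _ ⟨j, hj, rfl | rfl⟩
  · exact ⟨2, x_mem_wordSpan (proj D) hj⟩
  · exact ⟨1, grp_mem_wordSpan (proj D) (Submonoid.subset_closure ⟨j, hj, rfl⟩)⟩

theorem grp_mem_initialSubalgebra {s : ℕ} {h : Γ}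
    (hh : h ∈ Submonoid.closure {k | ∃ j : Fin θ, j.val < s ∧ k = D.g j}) :
    grp D h ∈ initialSubalgebra D s := by
  induction hh using Submonoid.closure_induction with
  | mem k hk =>
    obtain ⟨j, hj, rfl⟩ := hk
    exact Algebra.subset_adjoin ⟨j, hj, Or.inr rfl⟩
  | one => exact grp_one D ▸ one_mem _
  | mul a b _ _ ha hb => exact grp_mul D a b ▸ mul_mem ha hb

theorem monomial_mem_initialSubalgebra {s : ℕ} {n : Fin θ → ℕ}
    (hn : ∀ j : Fin θ, s ≤ j.val → n j = 0) : monomial D n ∈ initialSubalgebra D s := by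
  refine Subalgebra.list_prod_mem _ fun t ht => ?_
  obtain ⟨j, rfl⟩ := List.mem_ofFn.mp ht
  rcases lt_or_ge j.val s with hj | hj
  · have hx : x D j ∈ initialSubalgebra D s := Algebra.subset_adjoin ⟨j, hj, Or.inl rfl⟩
    exact pow_mem hx _
  · rw [hn j hj, pow_zero]
    exact one_mem _

theorem toSubmodule_initialSubalgebra (s : ℕ) :
    Subalgebra.toSubmodule (initialSubalgebra D s) =
      Submodule.span K {t : D.Biproduct | ∃ (h : Γ) (n : Fin θ → ℕ),
        h ∈ Submonoid.closure {k : Γ | ∃ j : Fin θ, j.val < s ∧ k = D.g j} ∧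
        (∀ j : Fin θ, j.val < s → n j ≤ D.r j - 1) ∧ (∀ j : Fin θ, s ≤ j.val → n j = 0) ∧
        t = grp D h * monomial D n} := by
  refine le_antisymm (fun t ht => ?_) (Submodule.span_le.mpr ?_)
  · obtain ⟨k, hk⟩ := initialSubalgebra_le_wordSubalgebra s ht
    refine Submodule.span_mono ?_ (wordSpan_proj_le_monomialSpan _ s k hk)
    rintro _ ⟨h, hh, n, hn, hs, _, rfl⟩
    refine ⟨h, n, hh, fun j _ => Nat.le_sub_one_of_lt (hn j), hs, ?_⟩
    rw [map_mul, proj_grp, proj_word_sortedWord]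
  · rintro _ ⟨h, n, hh, _, hs, rfl⟩
    exact (initialSubalgebra D s).mul_mem (grp_mem_initialSubalgebra hh)
      (monomial_mem_initialSubalgebra hs)

/-! ### The comultiplication and the filtration by word length -/

variable (D) in
/-- The span of the `a ⊗ b`, where `a` and `b` are combinations of the elements
`h x_{l₁} ⋯ x_{l_m}` with `m < k`. -/
def tensorWordSpan (k : ℕ) : Submodule K (D.Biproduct ⊗[K] D.Biproduct) :=
  Submodule.map₂ (TensorProduct.mk K _ _) (D.wordSpan (proj D) ⊤ θ k) (D.wordSpan (proj D) ⊤ θ k)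

theorem tmul_mem_tensorWordSpan {k : ℕ} {a b : D.Biproduct} (ha : a ∈ D.wordSpan (proj D) ⊤ θ k)
    (hb : b ∈ D.wordSpan (proj D) ⊤ θ k) : a ⊗ₜ[K] b ∈ tensorWordSpan D k :=
  Submodule.apply_mem_map₂ _ ha hb

theorem mul_mem_tensorWordSpan {a b c : ℕ} (habc : a + b ≤ c + 1)
    {t u : D.Biproduct ⊗[K] D.Biproduct} (ht : t ∈ tensorWordSpan D a)
    (hu : u ∈ tensorWordSpan D b) : t * u ∈ tensorWordSpan D c := by
  have hle : tensorWordSpan D a * tensorWordSpan D b ≤ tensorWordSpan D c := by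
    rw [tensorWordSpan, tensorWordSpan, Submodule.map₂_eq_span_image2,
      Submodule.map₂_eq_span_image2, Submodule.span_mul_span, Submodule.span_le]
    rintro _ ⟨_, ⟨p, hp, q, hq, rfl⟩, _, ⟨p', hp', q', hq', rfl⟩, rfl⟩
    change (p ⊗ₜ[K] q) * (p' ⊗ₜ[K] q') ∈ _
    rw [Algebra.TensorProduct.tmul_mul_tmul]
    exact tmul_mem_tensorWordSpan (mul_mem_wordSpan _ habc hp hp') (mul_mem_wordSpan _ habc hq hq')
  exact hle (Submodule.mul_mem_mul ht hu)

theorem comul_grp_mem_tensorWordSpan (h : Γ) :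
    comul (R := K) (grp D h) ∈ tensorWordSpan D 1 := by
  have hh := grp_mem_wordSpan (proj D) (s := θ) (Submonoid.mem_top h)
  exact comul_grp D h ▸ tmul_mem_tensorWordSpan hh hh

theorem comul_x_mem_tensorWordSpan (i : Fin θ) :
    comul (R := K) (x D i) ∈ tensorWordSpan D 2 := by
  have hx := x_mem_wordSpan (proj D) (H := ⊤) i.isLt
  have hle := wordSpan_mono (proj D) (H := ⊤) (s := θ) one_le_two
  exact comul_x D i ▸ add_mem
    (tmul_mem_tensorWordSpan hx (hle (one_mem_wordSpan _)))
    (tmul_mem_tensorWordSpan (hle (grp_mem_wordSpan _ (Submonoid.mem_top _))) hx)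

theorem comul_word_mem_tensorWordSpan (l : List (Fin θ)) :
    comul (R := K) (proj D (D.word l)) ∈ tensorWordSpan D (l.length + 1) := by
  induction l with
  | nil =>
    rw [word_nil, map_one, ← grp_one]
    exact comul_grp_mem_tensorWordSpan 1
  | cons i l ih =>
    rw [word_cons, map_mul, proj_x, Bialgebra.comul_mul]
    exact mul_mem_tensorWordSpan (by rw [List.length_cons]; lia) (comul_x_mem_tensorWordSpan i) ih

theorem comul_mem_tensorWordSpan {k : ℕ} {t : D.Biproduct}
    (ht : t ∈ D.wordSpan (proj D) ⊤ θ k) : comul (R := K) t ∈ tensorWordSpan D k := by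
  have hle : D.wordSpan (proj D) ⊤ θ k ≤ (tensorWordSpan D k).comap comul := by
    refine Submodule.span_le.mpr ?_
    rintro _ ⟨h, _, l, _, hl, rfl⟩
    change comul (R := K) (proj D _) ∈ tensorWordSpan D k
    rw [map_mul, proj_grp, Bialgebra.comul_mul]
    exact mul_mem_tensorWordSpan (by lia) (comul_grp_mem_tensorWordSpan h)
      (comul_word_mem_tensorWordSpan l)
  exact hle ht

end Biproduct

/-! ### The lifting -/

namespace LiftingScalars

variable (S : D.LiftingScalars)

/-- The quotient map from `T(W) # K[Γ]` to the lifting. -/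
def proj : D.TensorBiproduct →ₐ[K] S.Lifting := Ideal.Quotient.mkₐ K S.ideal

theorem proj_surjective : Function.Surjective S.proj := Ideal.Quotient.mkₐ_surjective K _

theorem proj_x_pow_r (i : Fin θ) : S.proj (TensorBiproduct.x D i ^ D.r i) =
    S.a i • (1 - S.proj (TensorBiproduct.grp D (D.g i ^ D.r i))) :=
  Ideal.Quotient.eq.mpr (S.relator_mem (.power i))

theorem proj_x_mul_x {i j : Fin θ} (hij : i ≠ j) :
    S.proj (TensorBiproduct.x D i * TensorBiproduct.x D j) -
        (D.χ j (D.g i) : K) • S.proj (TensorBiproduct.x D j * TensorBiproduct.x D i) =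
      S.b i j • (1 - S.proj (TensorBiproduct.grp D (D.g i * D.g j))) :=
  sub_eq_iff_eq_add'.mpr (Ideal.Quotient.eq.mpr (S.relator_mem (.link i j hij)))

theorem smul_one_sub_grp_mem_wordSpan {k : ℕ} (hk : 1 ≤ k) (c : K) (h : Γ) :
    c • (1 - S.proj (TensorBiproduct.grp D h)) ∈ D.wordSpan S.proj ⊤ θ k :=
  Submodule.smul_mem _ c <| wordSpan_mono S.proj hk <|
    sub_mem (one_mem_wordSpan S.proj) (grp_mem_wordSpan S.proj (Submonoid.mem_top h))

theorem wordSpan_proj_le_monomialSpan (k : ℕ) :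
    D.wordSpan S.proj ⊤ θ k ≤ D.monomialSpan S.proj ⊤ θ k := by
  refine wordSpan_le_monomialSpan S.proj (fun i j hij _ _ => ⟨D.χ j (D.g i), ?_⟩)
    (fun i _ => ?_) k
  · rw [S.proj_x_mul_x hij]
    exact S.smul_one_sub_grp_mem_wordSpan one_le_two _ _
  · rw [S.proj_x_pow_r]
    exact S.smul_one_sub_grp_mem_wordSpan (one_le_two.trans (D.two_le_r i)) _ _

theorem span_proj_sortedWord_eq_top :
    Submodule.span K (Set.range fun p : Γ × (∀ j, Fin (D.r j)) =>
      S.proj (TensorBiproduct.grp D p.1 * D.word (sortedWord fun j => p.2 j))) = ⊤ :=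
  span_grp_mul_sortedWord_eq_top S.proj_surjective S.wordSpan_proj_le_monomialSpan

/-- The linear map from the biproduct to the lifting that matches the monomials
`h x₁^{n₁} ⋯ x_θ^{n_θ}` with `n_j < r_j`. -/
def monomialMap : D.Biproduct →ₗ[K] S.Lifting :=
  (Biproduct.monomialBasis D).constr K fun p =>
    S.proj (TensorBiproduct.grp D p.1 * D.word (sortedWord fun j => p.2 j))

theorem monomialMap_proj (h : Γ) {n : Fin θ → ℕ} (hn : ∀ j, n j < D.r j) :
    S.monomialMap (Biproduct.proj D (TensorBiproduct.grp D h * D.word (sortedWord n))) =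
      S.proj (TensorBiproduct.grp D h * D.word (sortedWord n)) := by
  rw [← Biproduct.monomialBasis_apply (h, fun j => ⟨n j, hn j⟩)]
  exact Module.Basis.constr_basis ..

theorem monomialMap_surjective : Function.Surjective S.monomialMap :=
  LinearMap.range_eq_top.mp <|
    ((Biproduct.monomialBasis D).constr_range (S := K)).trans S.span_proj_sortedWord_eq_top

end LiftingScalars

namespace Biproduct

/-! ### Twisting the biproduct -/

theorem grp_pow (h : Γ) (n : ℕ) : grp D (h ^ n) = grp D h ^ n := by
  induction n with
  | zero => rw [pow_zero, pow_zero, grp_one]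
  | succ n ih => rw [pow_succ, pow_succ, grp_mul, ih]

section Twist

variable {γ : TwoCocycle K D.Biproduct}

theorem skewCorrection_comul_mem_wordSpan {k : ℕ} {y : D.Biproduct}
    (hy : y ∈ D.wordSpan (proj D) ⊤ θ k) (h : Γ) (z : D.Biproduct) :
    γ.skewCorrection (grp D h) z (comul y) ∈ D.wordSpan (proj D) ⊤ θ k := by
  have hle : tensorWordSpan D k ≤
      (D.wordSpan (proj D) ⊤ θ k).comap (γ.skewCorrection (grp D h) z) :=
    Submodule.map₂_le.mpr fun a ha b hb =>
      sub_mem (Submodule.smul_mem _ _ hb) <| Submodule.smul_mem _ _ <|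
        mul_mem_wordSpan _ le_rfl ha (grp_mem_wordSpan _ (Submonoid.mem_top h))
  exact hle (comul_mem_tensorWordSpan hy)

variable (hγ : γ.IsBilinearOver (groupSubalgebra D))
include hγ

theorem cocycle_tmul_grp (y : D.Biproduct) (h : Γ) :
    γ.toLinearMap (y ⊗ₜ grp D h) = counit (R := K) y := by
  have hy := hγ 1 (one_mem _) (grp D h) (Algebra.subset_adjoin ⟨h, rfl⟩) y 1
  rwa [one_mul, one_mul, γ.map_tmul_one, (isGroupLikeElem_grp D h).counit_eq_one,
    Bialgebra.counit_one, one_mul, one_mul] at hy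

theorem slice_unit_grp (h : Γ) : TwoCocycle.slice γ.unit.val (grp D h) = 1 :=
  TwoCocycle.slice_unit_eq_one fun y => cocycle_tmul_grp hγ y h

theorem cocycle_grp_mul_tmul (h : Γ) (y z : D.Biproduct) :
    γ.toLinearMap ((grp D h * y) ⊗ₜ z) = γ.toLinearMap (y ⊗ₜ z) := by
  have hy := hγ (grp D h) (Algebra.subset_adjoin ⟨h, rfl⟩) 1 (one_mem _) y z
  rwa [mul_one, (isGroupLikeElem_grp D h).counit_eq_one, Bialgebra.counit_one, one_mul,
    one_mul] at hy

theorem cocycle_grp_tmul_x (h : Γ) (i : Fin θ) : γ.toLinearMap (grp D h ⊗ₜ x D i) = 0 := by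
  rw [← mul_one (grp D h), cocycle_grp_mul_tmul hγ, γ.map_one_tmul, counit_x]

theorem cocycle_x_pow_mul_grp_tmul (i : Fin θ) (n : ℕ) (h : Γ) (z : D.Biproduct) :
    γ.toLinearMap ((x D i ^ n * grp D h) ⊗ₜ z) =
      (D.χ i h : K)⁻¹ ^ n * γ.toLinearMap ((x D i ^ n) ⊗ₜ z) := by
  rw [x_pow_mul_grp, ← TensorProduct.smul_tmul', map_smul, cocycle_grp_mul_tmul hγ, smul_eq_mul]

theorem twistedMul_tmul_grp (y : D.Biproduct) (h : Γ) :
    γ.twistedMul (y ⊗ₜ grp D h) = y * grp D h :=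
  TwoCocycle.twistedMul_tmul_of_isGroupLikeElem (isGroupLikeElem_grp D h) (slice_unit_grp hγ h) y

theorem twistedMul_tmul_x (y : D.Biproduct) (i : Fin θ) : γ.twistedMul (y ⊗ₜ x D i) =
    y * x D i + γ.skewCorrection (grp D (D.g i)) (x D i) (comul y) :=
  TwoCocycle.twistedMul_tmul_of_comul_eq (isGroupLikeElem_grp D _) (comul_x D i) (counit_x D i)
    (slice_unit_grp hγ _) y

theorem twistedMul_grp_tmul_x (h : Γ) (i : Fin θ) :
    γ.twistedMul (grp D h ⊗ₜ x D i) = grp D h * x D i := by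
  rw [twistedMul_tmul_x hγ, comul_grp, TwoCocycle.skewCorrection_tmul, cocycle_grp_tmul_x hγ,
    zero_smul, zero_smul, sub_zero, add_zero]

theorem twistedMul_x_tmul_x (i j : Fin θ) : γ.twistedMul (x D i ⊗ₜ x D j) =
    x D i * x D j + γ.toLinearMap (x D i ⊗ₜ x D j) • (1 - grp D (D.g i * D.g j)) := by
  rw [twistedMul_tmul_x hγ, comul_x, map_add, TwoCocycle.skewCorrection_tmul,
    TwoCocycle.skewCorrection_tmul, cocycle_grp_tmul_x hγ, γ.map_one_tmul, counit_x, grp_mul,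
    zero_smul, zero_smul, sub_zero, zero_sub, ← sub_eq_add_neg, smul_sub]

theorem skewCorrection_comul_x_pow {i : Fin θ} {n : ℕ}
    (h0 : ∀ m < n, γ.toLinearMap ((x D i ^ m) ⊗ₜ x D i) = 0) :
    γ.skewCorrection (grp D (D.g i)) (x D i) (comul (x D i ^ n)) =
      γ.toLinearMap ((x D i ^ n) ⊗ₜ x D i) • (1 - grp D (D.g i ^ (n + 1))) := by
  have hfirst : ∑ k ∈ Finset.range (n + 1), qBinom (D.χ i (D.g i) : K) n k •
      γ.toLinearMap ((x D i ^ k * grp D (D.g i ^ (n - k))) ⊗ₜ x D i) • x D i ^ (n - k) =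
      γ.toLinearMap ((x D i ^ n) ⊗ₜ x D i) • 1 := by
    rw [Finset.sum_range_succ, Finset.sum_eq_zero fun k hk => ?_, zero_add, qBinom_self, one_smul,
      Nat.sub_self, pow_zero, pow_zero, grp_one, mul_one]
    rw [cocycle_x_pow_mul_grp_tmul hγ, h0 k (Finset.mem_range.mp hk), mul_zero, zero_smul,
      smul_zero]
  have hsecond : ∑ k ∈ Finset.range (n + 1), qBinom (D.χ i (D.g i) : K) n k •
      γ.toLinearMap ((x D i ^ (n - k)) ⊗ₜ x D i) •
        (x D i ^ k * grp D (D.g i ^ (n - k)) * grp D (D.g i)) =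
      γ.toLinearMap ((x D i ^ n) ⊗ₜ x D i) • grp D (D.g i ^ (n + 1)) := by
    rw [Finset.sum_range_succ', Finset.sum_eq_zero fun k hk => ?_, zero_add, qBinom_zero, one_smul,
      Nat.sub_zero, pow_zero, one_mul, ← grp_mul, ← pow_succ]
    have hk := Finset.mem_range.mp hk
    rw [h0 _ (by lia), zero_smul, smul_zero]
  rw [smul_sub, ← hfirst, ← hsecond, ← Finset.sum_sub_distrib, comul_x_pow, map_sum]
  refine Finset.sum_congr rfl fun k _ => ?_
  rw [map_smul, TwoCocycle.skewCorrection_tmul, smul_sub, grp_pow]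

/-- The algebra map `T(W) # K[Γ] → A^γ` fixing the generators. -/
def toTwistHom : D.TensorBiproduct →ₐ[K] γ.Twist :=
  TensorBiproduct.lift (fun h => γ.toTwist (grp D h)) (fun i => γ.toTwist (x D i))
    (by rw [grp_one, γ.toTwist_one])
    (fun h k => by rw [γ.toTwist_mul_toTwist, twistedMul_tmul_grp hγ, grp_mul])
    (fun h i => by
      rw [γ.toTwist_mul_toTwist, γ.toTwist_mul_toTwist, twistedMul_tmul_grp hγ,
        twistedMul_grp_tmul_x hγ, grp_mul_x, map_smul])

theorem toTwistHom_grp (h : Γ) :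
    toTwistHom hγ (TensorBiproduct.grp D h) = γ.toTwist (grp D h) :=
  TensorBiproduct.lift_grp ..

theorem toTwistHom_x (i : Fin θ) :
    toTwistHom hγ (TensorBiproduct.x D i) = γ.toTwist (x D i) :=
  TensorBiproduct.lift_x ..

theorem counit_comp_toTwistHom : (Bialgebra.counitAlgHom K γ.Twist).comp (toTwistHom hγ) =
    Bialgebra.counitAlgHom K D.TensorBiproduct := by
  refine TensorBiproduct.algHom_ext (fun h => ?_) fun i => ?_
  · change counit (R := K) (toTwistHom hγ _) = counit (R := K) (TensorBiproduct.grp D h)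
    rw [toTwistHom_grp, TensorBiproduct.counit_grp]
    exact (isGroupLikeElem_grp D h).counit_eq_one
  · change counit (R := K) (toTwistHom hγ _) = counit (R := K) (TensorBiproduct.x D i)
    rw [toTwistHom_x, TensorBiproduct.counit_x]
    exact counit_x D i

theorem map_toTwistHom_comp_comul :
    (Algebra.TensorProduct.map (toTwistHom hγ) (toTwistHom hγ)).comp
      (Bialgebra.comulAlgHom K D.TensorBiproduct) =
    (Bialgebra.comulAlgHom K γ.Twist).comp (toTwistHom hγ) := by
  refine TensorBiproduct.algHom_ext (fun h => ?_) fun i => ?_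
  · change Algebra.TensorProduct.map _ _ (comul (R := K) (TensorBiproduct.grp D h)) =
      comul (R := K) (toTwistHom hγ _)
    rw [TensorBiproduct.comul_grp, Algebra.TensorProduct.map_tmul, toTwistHom_grp]
    exact (comul_grp D h).symm
  · change Algebra.TensorProduct.map _ _ (comul (R := K) (TensorBiproduct.x D i)) =
      comul (R := K) (toTwistHom hγ _)
    rw [TensorBiproduct.comul_x, map_add, Algebra.TensorProduct.map_tmul,
      Algebra.TensorProduct.map_tmul, toTwistHom_grp, toTwistHom_x, map_one]
    exact (comul_x D i).symm

theorem toTwistHom_x_pow {i : Fin θ} {n : ℕ}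
    (h0 : ∀ m < n, γ.toLinearMap ((x D i ^ m) ⊗ₜ x D i) = 0) :
    toTwistHom hγ (TensorBiproduct.x D i ^ n) = γ.toTwist (x D i ^ n) := by
  induction n with
  | zero => rw [pow_zero, pow_zero, map_one, γ.toTwist_one]
  | succ n ih =>
    have hlt : ∀ m < n, γ.toLinearMap ((x D i ^ m) ⊗ₜ x D i) = 0 :=
      fun m hm => h0 m (hm.trans n.lt_succ_self)
    rw [pow_succ, map_mul, ih hlt, toTwistHom_x, γ.toTwist_mul_toTwist, twistedMul_tmul_x hγ,
      skewCorrection_comul_x_pow hγ hlt, h0 n n.lt_succ_self, zero_smul, add_zero, pow_succ]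

theorem toTwistHom_x_pow_r {i : Fin θ}
    (h0 : ∀ n, n + 1 < D.r i → γ.toLinearMap ((x D i ^ n) ⊗ₜ x D i) = 0) :
    toTwistHom hγ (TensorBiproduct.x D i ^ D.r i) = γ.toTwist
      (γ.toLinearMap ((x D i ^ (D.r i - 1)) ⊗ₜ x D i) • (1 - grp D (D.g i ^ D.r i))) := by
  have hlt : ∀ m < D.r i - 1, γ.toLinearMap ((x D i ^ m) ⊗ₜ x D i) = 0 :=
    fun m hm => h0 m (Nat.add_lt_of_lt_sub hm)
  have hr : D.r i - 1 + 1 = D.r i := Nat.sub_add_cancel (one_le_two.trans (D.two_le_r i))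
  have hpow : TensorBiproduct.x D i ^ D.r i =
      TensorBiproduct.x D i ^ (D.r i - 1) * TensorBiproduct.x D i := by rw [← pow_succ, hr]
  rw [hpow, map_mul, toTwistHom_x_pow hγ hlt, toTwistHom_x, γ.toTwist_mul_toTwist,
    twistedMul_tmul_x hγ, skewCorrection_comul_x_pow hγ hlt, ← pow_succ, hr, x_pow_r, zero_add]

theorem toTwistHom_x_mul_x (i j : Fin θ) :
    toTwistHom hγ (TensorBiproduct.x D i * TensorBiproduct.x D j) = γ.toTwist
      (x D i * x D j + γ.toLinearMap (x D i ⊗ₜ x D j) • (1 - grp D (D.g i * D.g j))) := by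
  rw [map_mul, toTwistHom_x, toTwistHom_x, γ.toTwist_mul_toTwist, twistedMul_x_tmul_x hγ]

theorem toTwist_symm_toTwistHom_mul_x (t : D.TensorBiproduct) (i : Fin θ) :
    γ.toTwist.symm (toTwistHom hγ (t * TensorBiproduct.x D i)) =
      γ.toTwist.symm (toTwistHom hγ t) * x D i + γ.skewCorrection (grp D (D.g i)) (x D i)
        (comul (γ.toTwist.symm (toTwistHom hγ t))) := by
  rw [← twistedMul_tmul_x hγ, map_mul, toTwistHom_x]
  rfl

/-- Twisting does not change leading terms, since `skewCorrection` does not raise the degree while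
multiplication by `xᵢ` does. -/
theorem toTwist_symm_toTwistHom_sub_proj_mem_wordSpan (h : Γ) (l : List (Fin θ)) :
    γ.toTwist.symm (toTwistHom hγ (TensorBiproduct.grp D h * D.word l)) -
      proj D (TensorBiproduct.grp D h * D.word l) ∈ D.wordSpan (proj D) ⊤ θ l.length := by
  induction l using List.reverseRecOn with
  | nil =>
    rw [word_nil, mul_one, toTwistHom_grp, proj_grp, CoalgEquiv.symm_apply_apply, sub_self]
    exact zero_mem _
  | append_singleton l i ih =>
    set t := TensorBiproduct.grp D h * D.word l
    have ht : proj D t ∈ D.wordSpan (proj D) ⊤ θ (l.length + 1) :=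
      mem_wordSpan _ (Submonoid.mem_top h) (fun j _ => j.isLt) l.length.lt_succ_self
    have hsymm : γ.toTwist.symm (toTwistHom hγ t) ∈ D.wordSpan (proj D) ⊤ θ (l.length + 1) :=
      (Submodule.sub_mem_iff_left _ ht).mp (wordSpan_mono _ l.length.le_succ ih)
    have hword : TensorBiproduct.grp D h * D.word (l ++ [i]) = t * TensorBiproduct.x D i := by
      rw [word_append, word_cons, word_nil, mul_one, ← mul_assoc]
    rw [hword, toTwist_symm_toTwistHom_mul_x, map_mul (proj D) t, proj_x, add_sub_right_comm,
      ← sub_mul, List.length_append, List.length_singleton]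
    exact add_mem (mul_mem_wordSpan _ (by lia) ih (x_mem_wordSpan _ i.isLt))
      (skewCorrection_comul_mem_wordSpan hsymm _ _)

theorem toTwistHom_one_sub_grp (h : Γ) :
    toTwistHom hγ (1 - TensorBiproduct.grp D h) = γ.toTwist (1 - grp D h) := by
  rw [map_sub, map_sub, map_one, toTwistHom_grp, γ.toTwist_one]

theorem toTwistHom_relator (S : D.LiftingScalars)
    (h1 : ∀ i n, n + 1 < D.r i → γ.toLinearMap ((x D i ^ n) ⊗ₜ x D i) = 0)
    (h2 : ∀ i j, i < j → γ.toLinearMap (x D i ⊗ₜ x D j) = 0)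
    (h3 : ∀ i, γ.toLinearMap ((x D i ^ (D.r i - 1)) ⊗ₜ x D i) = S.a i)
    (h4 : ∀ i j, j < i → γ.toLinearMap (x D i ⊗ₜ x D j) = S.b i j)
    {t : D.TensorBiproduct} (ht : S.Relator t) : toTwistHom hγ t = 0 := by
  cases ht with
  | power i =>
    rw [map_sub, toTwistHom_x_pow_r hγ (h1 i), h3, map_smul, map_smul,
      toTwistHom_one_sub_grp, sub_self]
  | link i j hij =>
    have hcoeff : γ.toLinearMap (x D i ⊗ₜ x D j) =
        (D.χ j (D.g i) : K) * γ.toLinearMap (x D j ⊗ₜ x D i) + S.b i j := by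
      rcases lt_or_gt_of_ne hij with h | h
      · rw [h2 i j h, h4 j i h, S.b_symm i j hij, mul_neg, ← mul_assoc,
          mul_inv_cancel₀ (Units.ne_zero _), one_mul, neg_add_cancel]
      · rw [h2 j i h, h4 i j h, mul_zero, zero_add]
    rw [map_sub, map_add, map_smul, map_smul, toTwistHom_x_mul_x, toTwistHom_x_mul_x,
      toTwistHom_one_sub_grp, ← map_smul, ← map_smul, ← map_add, x_mul_x D hij, hcoeff,
      mul_comm (D.g j), smul_add, smul_smul, add_smul, add_assoc, sub_self]

/-- The bialgebra map from the lifting to `A^γ` induced by `toTwistHom`. -/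
def liftingToTwist (S : D.LiftingScalars) (hS : ∀ t, S.Relator t → toTwistHom hγ t = 0) :
    S.Lifting →ₐc[K] γ.Twist :=
  BialgHom.ofAlgHom (Ideal.Quotient.liftₐ S.ideal (toTwistHom hγ) (S.ideal_le_ker _ hS))
    (Ideal.Quotient.algHom_ext K (counit_comp_toTwistHom hγ))
    (Ideal.Quotient.algHom_ext K <| AlgHom.ext fun t => by
      change TensorProduct.map _ _ (TensorProduct.map S.proj.toLinearMap S.proj.toLinearMap
        (comul (R := K) t)) = _
      rw [← LinearMap.comp_apply, ← TensorProduct.map_comp]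
      exact DFunLike.congr_fun (map_toTwistHom_comp_comul hγ) t)

theorem liftingToTwist_proj (S : D.LiftingScalars)
    (hS : ∀ t, S.Relator t → toTwistHom hγ t = 0) (t : D.TensorBiproduct) :
    liftingToTwist hγ S hS (S.proj t) = toTwistHom hγ t := rfl

theorem toTwist_symm_liftingToTwist_monomialMap_sub_mem_wordSpan (S : D.LiftingScalars)
    (hS : ∀ t, S.Relator t → toTwistHom hγ t = 0) {k : ℕ} {t : D.Biproduct}
    (ht : t ∈ D.wordSpan (proj D) ⊤ θ (k + 1)) :
    γ.toTwist.symm (liftingToTwist hγ S hS (S.monomialMap t)) - t ∈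
      D.wordSpan (proj D) ⊤ θ k := by
  let T : D.Biproduct →ₗ[K] D.Biproduct := γ.toTwist.symm.toCoalgHom.toLinearMap ∘ₗ
    (liftingToTwist hγ S hS : S.Lifting →ₗ[K] γ.Twist) ∘ₗ S.monomialMap
  have hle : D.monomialSpan (proj D) ⊤ θ (k + 1) ≤
      (D.wordSpan (proj D) ⊤ θ k).comap (T - LinearMap.id) := by
    refine Submodule.span_le.mpr ?_
    rintro _ ⟨h, _, n, hn, _, hk, rfl⟩
    change γ.toTwist.symm (liftingToTwist hγ S hS (S.monomialMap _)) - _ ∈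
      D.wordSpan (proj D) ⊤ θ k
    rw [S.monomialMap_proj h hn, liftingToTwist_proj]
    exact wordSpan_mono _ (Nat.le_of_lt_succ hk)
      (toTwist_symm_toTwistHom_sub_proj_mem_wordSpan hγ h _)
  exact hle (wordSpan_proj_le_monomialSpan ⊤ θ (k + 1) ht)

theorem liftingToTwist_bijective (S : D.LiftingScalars)
    (hS : ∀ t, S.Relator t → toTwistHom hγ t = 0) :
    Function.Bijective (liftingToTwist hγ S hS) := by
  let T : D.Biproduct →ₗ[K] D.Biproduct := γ.toTwist.symm.toCoalgHom.toLinearMap ∘ₗ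
    (liftingToTwist hγ S hS : S.Lifting →ₗ[K] γ.Twist) ∘ₗ S.monomialMap
  have hT : Function.Bijective T :=
    bijective_of_sub_mem_filtration (D.wordSpan (proj D) ⊤ θ) (wordSpan_zero _)
      ((proj_surjective D).forall.mpr (exists_mem_wordSpan _)) T fun _ _ ht =>
        toTwist_symm_liftingToTwist_monomialMap_sub_mem_wordSpan hγ S hS ht
  have hcomp : Function.Bijective (liftingToTwist hγ S hS ∘ S.monomialMap) :=
    (Function.Bijective.of_comp_iff' γ.toTwist.symm.bijective _).mp hT
  exact (Function.Bijective.of_comp_iff _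
    ⟨hcomp.injective.of_comp, S.monomialMap_surjective⟩).mp hcomp

end Twist

end Biproduct

end QuantumLinearSpace

open QuantumLinearSpace.Biproduct in
theorem mainTheorem7_general {K : Type*} [Field K] {Γ : Type*} [CommGroup Γ] {θ : ℕ}
    (D : QuantumLinearSpace K Γ θ) (S : D.LiftingScalars) :
    (∀ s : ℕ, Subalgebra.toSubmodule (initialSubalgebra D s) =
      Submodule.span K {t : D.Biproduct | ∃ (h : Γ) (n : Fin θ → ℕ),
        h ∈ Submonoid.closure {k : Γ | ∃ j : Fin θ, j.val < s ∧ k = D.g j} ∧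
        (∀ j : Fin θ, j.val < s → n j ≤ D.r j - 1) ∧ (∀ j : Fin θ, s ≤ j.val → n j = 0) ∧
        t = grp D h * monomial D n}) ∧
    ∀ γ : TwoCocycle K D.Biproduct, γ.IsBilinearOver (groupSubalgebra D) →
      (∀ (i : Fin θ) (n : ℕ), n + 1 < D.r i → γ.toLinearMap ((x D i ^ n) ⊗ₜ x D i) = 0) →
      (∀ i j : Fin θ, i < j → γ.toLinearMap (x D i ⊗ₜ x D j) = 0) →
      (∀ i : Fin θ, γ.toLinearMap ((x D i ^ (D.r i - 1)) ⊗ₜ x D i) = S.a i) →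
      (∀ i j : Fin θ, j < i → γ.toLinearMap (x D i ⊗ₜ x D j) = S.b i j) →
      Nonempty (γ.Twist ≃ₐc[K] S.Lifting) :=
  ⟨toSubmodule_initialSubalgebra, fun _ hγ h1 h2 h3 h4 =>
    ⟨(BialgEquiv.ofBijective _ (liftingToTwist_bijective hγ S fun _ =>
      toTwistHom_relator hγ S h1 h2 h3 h4)).symm⟩⟩

end

theorem mainTheorem7 {K : Type*} [Field K] [CharZero K] {Γ : Type*} [CommGroup Γ] [Finite Γ]
    {θ : ℕ} (D : QuantumLinearSpace K Γ θ) (S : D.LiftingScalars) :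
    (∀ s : ℕ, 1 ≤ s → s < θ →
      Subalgebra.toSubmodule (QuantumLinearSpace.Biproduct.initialSubalgebra D s) =
        Submodule.span K {t : D.Biproduct | ∃ (h : Γ) (n : Fin θ → ℕ),
          h ∈ Subgroup.closure {k : Γ | ∃ j : Fin θ, j.val < s ∧ k = D.g j} ∧
          (∀ j : Fin θ, j.val < s → n j ≤ D.r j - 1) ∧ (∀ j : Fin θ, s ≤ j.val → n j = 0) ∧
          t = QuantumLinearSpace.Biproduct.grp D h *
            QuantumLinearSpace.Biproduct.monomial D n}) ∧
    ∀ γ : TwoCocycle K D.Biproduct,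
      γ.IsBilinearOver (QuantumLinearSpace.Biproduct.groupSubalgebra D) →
      (∀ (i : Fin θ) (n m : ℕ), n + m ≤ D.r i - 1 →
        γ.toLinearMap ((QuantumLinearSpace.Biproduct.x D i ^ n) ⊗ₜ
            (QuantumLinearSpace.Biproduct.x D i ^ m)) =
          counit (R := K) (QuantumLinearSpace.Biproduct.x D i ^ n) *
            counit (R := K) (QuantumLinearSpace.Biproduct.x D i ^ m)) →
      (∀ s : Fin θ, 0 < s.val →
        ∀ z ∈ QuantumLinearSpace.Biproduct.initialSubalgebra D s.val,
        ∀ n : ℕ, n ≤ D.r s - 1 →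
          γ.toLinearMap (z ⊗ₜ (QuantumLinearSpace.Biproduct.x D s ^ n)) =
            counit (R := K) z * counit (R := K) (QuantumLinearSpace.Biproduct.x D s ^ n)) →
      (∀ i : Fin θ,
        γ.toLinearMap ((QuantumLinearSpace.Biproduct.x D i ^ (D.r i - 1)) ⊗ₜ
          QuantumLinearSpace.Biproduct.x D i) = S.a i) →
      (∀ i j : Fin θ, j < i →
        γ.toLinearMap (QuantumLinearSpace.Biproduct.x D i ⊗ₜ
          QuantumLinearSpace.Biproduct.x D j) = S.b i j) →
      Nonempty (γ.Twist ≃ₐc[K] S.Lifting) := by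
  obtain ⟨hspan, hiso⟩ := mainTheorem7_general D S
  refine ⟨fun s _ _ => ?_, fun γ hγ h1 h2 h3 h4 => hiso γ hγ (fun i n hn => ?_)
    (fun i j hij => ?_) h3 h4⟩
  · simpa only [← Subgroup.mem_toSubmonoid, Subgroup.closure_toSubmonoid_of_finite] using hspan s
  · simpa only [pow_one, QuantumLinearSpace.Biproduct.counit_x, mul_zero] using
      h1 i n 1 (Nat.le_sub_one_of_lt hn)
  · have hr : 1 ≤ D.r j - 1 := Nat.le_sub_one_of_lt (D.two_le_r j)
    simpa only [pow_one, QuantumLinearSpace.Biproduct.counit_x, mul_zero] using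
      h2 j (Nat.zero_lt_of_lt hij) _ (Algebra.subset_adjoin ⟨i, hij, Or.inl rfl⟩) 1 hr
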